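/- **Notation.** Let $\mathbb D=\{z\in\mathbb C: |z|\le 1\}$. An index is a tuple of positive integers. A pair $\binom{\boldsymbol z}{\boldsymbol k}$ consists of an index $\boldsymbol k=(k_1,\dots,k_r)$ and $\boldsymbol z\in\mathbb D^r$; powers use $0^0=1$. The shuffle-type multiple polylogarithm is $$\mathrm{Li}^{\mathrm{sh}}_{\boldsymbol k}(\boldsymbol z)=\sum_{0=m_0<m_1<\cdots<m_r}\ \prod_{i=1}^r\frac{z_i^{m_i-m_{i-1}}}{m_i^{k_i}}.$$ For pairs $\binom{\boldsymbol z_j}{\boldsymbol k_j}$ of depth $r_j$ ($1\le j\le n$) and $\binom{\boldsymbol w}{\boldsymbol l}$ of depth $s\ge1$, the multivariable connected sum is $$Z_n\Big(\tbinom{\boldsymbol z_1}{\boldsymbol k_1};\dots;\tbinom{\boldsymbol z_n}{\boldsymbol k_n}\,\Big|\,\tbinom{\boldsymbol w}{\boldsymbol l}\Big)=\sum \frac{\prod_{j} m^{(j)}_{r_j}!}{\big(\sum_j m^{(j)}_{r_j}\big)!}\ \prod_{j=1}^n\prod_{i=1}^{r_j}\frac{(z^{(j)}_i)^{m^{(j)}_i-m^{(j)}_{i-1}}}{(m^{(j)}_i)^{k^{(j)}_i}}\cdot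 q_s\prod_{i=1}^s\frac{w_i^{q_i-q_{i-1}}}{q_i^{l_i}},$$ summed over all $0=m^{(j)}_0<m^{(j)}_1<\cdots<m^{(j)}_{r_j}$ ($1\le j\le n$) and $0=q_0<q_1\le\cdots\le q_s=\sum_j m^{(j)}_{r_j}$; for $s=0$ it is $0$ by convention. For $t\in\mathbb D$ let $\mathbb B_m(t)$ be the set of $(v_1,\dots,v_m)\in((\mathbb D\setminus\{0\})\cup\{\infty\})^m$ with $\sum_i 1/v_i=t$ or $|t-\sum_i 1/v_i|\ge1$ (where $1/\infty=0$). For $j\in\{1,\dots,n\}$, the variables $(\boldsymbol z_1,\dots,\boldsymbol z_n;\boldsymbol w)$ are *transportable at $j$* if for every non-empty $J\subset\{1,\dots,n\}\setminus\{j\}$, every choice of positions $a_i\in\{1,\dots,r_i\}$ $(i\in J)$ and every component $w_k$ of $\boldsymbol w$ one has $(z^{(i)}_{a_i})_{i\in J}\in\mathbb B_{\#J}(w_k)$, and $|w_k-1/z^{(i)}_1|\ne1$ for every $i\ne j$ and every $w_k$ with $|w_k|=1$. They are *transportable* if they are transportable at some $j$. *Arrows.* $\binom{\boldsymbol z}{\boldsymbol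 k}_{\uparrow}$ adds $1$ to the last entry of $\boldsymbol k$ (and fixes $\binom{\varnothing}{\varnothing}$). On the components $1,\dots,n$: for $v\in\mathbb D\setminus\{0\}$, $\binom{\boldsymbol z}{\boldsymbol k}_{\to v}$ appends the column $\binom v1$, and $\binom{\boldsymbol z}{\boldsymbol k}_{\to\infty}=-\binom{\boldsymbol z}{\boldsymbol k}_{\uparrow}$, the sign being a factor of the value of $Z_n$. To the right of the bar: $\binom{\boldsymbol w}{\boldsymbol l}_{\to t}$ appends $\binom t1$ if $0\neq t\in\mathbb D$, and $\binom{\boldsymbol w}{\boldsymbol l}_{\to 0}=\binom{\boldsymbol w}{\boldsymbol l}_{\uparrow}$. *Transport relation* ($n\ge2$; each $A_i$ and $W$ denotes a pair): with $1/v_n=t-\sum_{i<n}1/v_i$, $$Z_n(\dots;(A_i)_{\to v_i};\dots;A_n\mid W_{\to t})=-\sum_{i<n}Z_n(\dots;A_i;\dots;(A_n)_{\to v_n}\mid W_{\to t})-Z_n(\dots;(A_i)_{\to v_i};\dots;(A_n)_{\to v_n}\mid W),$$ where in the $i$-th summand only the $i$-th component carries no arrow. It may be applied when $t\in\mathbb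 D$, $(v_1,\dots,v_{n-1})\in\mathbb B_{n-1}(t)$, $v_n\in(\mathbb D\setminus\{0\})\cup\{\infty\}$; $v_i\ne\infty$ whenever $A_i=\varnothing$ ($i<n$); $\sum_{i<n}1/v_i\neq t$ if $A_n=\varnothing$; and, if $n=2$ and $|t|=1$: $|t-1/v_1|\neq1$ if $A_1=\varnothing$, and $|v_1|\ne1$ if $A_2=\varnothing$. *Boundary condition.* It applies to $Z_1\big(\binom{\boldsymbol z}{\boldsymbol k}\mid\binom{\boldsymbol w}{\boldsymbol l}\big)$ with non-empty indices of depths $r,s$ such that $|z_r|<1$ or $|w_s|<1$ if $k_r=l_s=1$. The sum over $q_1\le\cdots\le q_s$ is split into sums over strict chains according to which neighbours are equal: if $q_i=q_{i+1}$, the columns $\binom{w_i}{l_i},\binom{w_{i+1}}{l_{i+1}}$ merge to $\binom{w_i}{l_i+l_{i+1}}$. Each strict chain is then interleaved in all possible ways (equalities allowed) with $m_1<\cdots<m_r$, subject to $m_r=$ the last $q$. A segment of the merged chain lying in $(m_{i-1},m_i]$ and in $(q_{j-1},q_j]$ gets the variable $z_iw_j$; its exponent is $k_i$, $l_j$ or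 $k_i+l_j$ according as its endpoint is $m_i$ only, $q_j$ only, or both, except that the last exponent is $k_r+l_s-1$ (with $l_s$ the last exponent after merging). The outcome is the formal sum of the resulting pairs. *The recipe with respect to $j$*: interchange the $j$-th and the $n$-th components; then apply transport relations repeatedly, always towards the last component, omitting empty components (which lowers $n$), replacing a sum with nothing to the right of the bar by $0$, and reading a last column $\binom01$ to the right of the bar as the arrow $\to0$, until only $Z_1$-values are left; apply the boundary condition to each of them. The outcome is a formal $\mathbb Z$-linear combination of pairs $\binom{\boldsymbol z}{\boldsymbol k}$. **Theorem.** Let $n\ge2$, let $\binom{\boldsymbol z_1}{\boldsymbol k_1},\dots,\binom{\boldsymbol z_n}{\boldsymbol k_n}$ and $\binom{\boldsymbol w}{\boldsymbol l}$ be pairs with non-empty indices, and put $\boldsymbol w^+=\boldsymbol w$ if $\boldsymbol l=(1,\dots,1)$ and $\boldsymbol w^+=(\boldsymbol w,0)$ otherwise. Assume that $(\boldsymbol z_1,\dots,\boldsymbol z_n;\boldsymbol w^+)$ is transportable. Then: 1. The series $Z_n\big(\binom{\boldsymbol z_1}{\boldsymbol k_1};\dots;\binom{\boldsymbol z_n}{\boldsymbol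 k_n}\mid\binom{\boldsymbol w}{\boldsymbol l}\big)$ converges absolutely, and its value is a $\mathbb Z$-linear combination of absolutely convergent shuffle-type multiple polylogarithms of positive depth. 2. Explicitly, let $j$ be any integer such that $(\boldsymbol z_1,\dots,\boldsymbol z_n;\boldsymbol w^+)$ is transportable at $j$, and suppose that, if $\boldsymbol k_i\ne(1,\dots,1)$ for some $i\neq j$, every component $w_k$ of $\boldsymbol w$ satisfies $w_k=0$ or $|w_k|=1$ (that is, $\infty\in\mathbb B_1(w_k)$). Then the recipe with respect to $j$ can be carried out to the end, every step being permitted, and every outcome $\sum_X c_X X$ of it consists of data $X$ of absolutely convergent shuffle-type multiple polylogarithms of positive depth and satisfies $$Z_n\Big(\tbinom{\boldsymbol z_1}{\boldsymbol k_1};\dots;\tbinom{\boldsymbol z_n}{\boldsymbol k_n}\,\Big|\,\tbinom{\boldsymbol w}{\boldsymbol l}\Big)=\sum_X c_X\,\mathrm{Li}^{\mathrm{sh}}(X).$$ -/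

import Mathlib

open scoped OnePoint

namespace ConnectedSum

noncomputable section

/-! ### Indices with variables -/

/-- A column `(z over k)`: an index `k = (k₁, …, k_r)` together with a tuple of variables
`z = (z₁, …, z_r)`, written as the list `[(z₁, k₁), …, (z_r, k_r)]`. The empty list is the pair
`(∅ over ∅)`. -/
abbrev VarIndex := List (ℂ × ℕ)

/-- The variables lie in the closed unit disk and the entries of the index are positive. -/
def Valid (A : VarIndex) : Prop := ∀ c ∈ A, ‖c.1‖ ≤ 1 ∧ 1 ≤ c.2

/-- The tuple of variables. -/
def vars (A : VarIndex) : List ℂ := A.map Prod.fst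

/-- The index is of the form `(1, …, 1)`. -/
def AllOnes (A : VarIndex) : Prop := ∀ c ∈ A, c.2 = 1

/-! ### The series -/

/-- Strictly increasing chains `0 = m₀ < m₁ < ⋯ < m_r`. -/
def strictChains (r : ℕ) : Set (Fin (r + 1) → ℕ) :=
  {m | m 0 = 0 ∧ StrictMono m}

/-- Chains `0 = q₀ < q₁ ≤ ⋯ ≤ q_s = N`. -/
def weakChains (s N : ℕ) : Set (Fin (s + 1) → ℕ) :=
  {q | q 0 = 0 ∧ (∀ i, i ≠ 0 → 0 < q i) ∧ Monotone q ∧ q (Fin.last s) = N}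

/-- `∏ i, z_i ^ (m_i - m_{i-1}) / m_i ^ k_i`, with `0 ^ 0 = 1`. -/
def chainTerm (A : VarIndex) (m : Fin (A.length + 1) → ℕ) : ℂ :=
  ∏ i : Fin A.length, (A.get i).1 ^ (m i.succ - m i.castSucc) / (m i.succ : ℂ) ^ (A.get i).2

/-- The shuffle-type multiple polylogarithm `Li^sh_k(z)`. -/
def Li (A : VarIndex) : ℂ := ∑' m : strictChains A.length, chainTerm A m

/-- `A` is the datum of an absolutely convergent shuffle-type multiple polylogarithm. -/
def IsConvergentMPL (A : VarIndex) : Prop :=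
  A ≠ [] ∧ Valid A ∧ Summable fun m : strictChains A.length => ‖chainTerm A m‖

/-- The connector `a₁! ⋯ a_n! / (a₁ + ⋯ + a_n)!`. -/
def connector {n : ℕ} (a : Fin n → ℕ) : ℂ :=
  (∏ i, ((a i).factorial : ℂ)) / ((∑ i, a i).factorial : ℂ)

/-- The tuples `(m⁽¹⁾, …, m⁽ⁿ⁾, q)` over which a multivariable connected sum is taken. -/
def summationSet {n : ℕ} (A : Fin n → VarIndex) (W : VarIndex) :
    Set (((j : Fin n) → Fin ((A j).length + 1) → ℕ) × (Fin (W.length + 1) → ℕ)) :=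
  {p | (∀ j, p.1 j ∈ strictChains (A j).length) ∧
    p.2 ∈ weakChains W.length (∑ j, p.1 j (Fin.last _))}

/-- The general term of a multivariable connected sum. -/
def connTerm {n : ℕ} (A : Fin n → VarIndex) (W : VarIndex)
    (p : ((j : Fin n) → Fin ((A j).length + 1) → ℕ) × (Fin (W.length + 1) → ℕ)) : ℂ :=
  connector (fun j => p.1 j (Fin.last _)) * (∏ j, chainTerm (A j) (p.1 j)) *
    ((p.2 (Fin.last _) : ℂ) * chainTerm W p.2)

open Classical in
/-- The multivariable connected sum `Z_n(A₁; …; A_n | W)`; it is `0` by convention if `W` is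
empty. -/
def Z {n : ℕ} (A : Fin n → VarIndex) (W : VarIndex) : ℂ :=
  if W = [] then 0 else ∑' p : summationSet A W, connTerm A W p

/-- The value of a formal `ℤ`-linear combination of multiple polylogarithms. -/
def evalLi (c : VarIndex →₀ ℤ) : ℂ := c.sum fun A a => (a : ℂ) * Li A

/-! ### Transportable variables -/

/-- `1 / v`, where `1 / ∞ = 0`. -/
def recip : OnePoint ℂ → ℂ
  | ∞ => 0
  | (z : ℂ) => z⁻¹

/-- The set `(𝔻 ∖ {0}) ∪ {∞}`. -/
def params : Set (OnePoint ℂ) := {v | v = ∞ ∨ ∃ z : ℂ, v = z ∧ z ≠ 0 ∧ ‖z‖ ≤ 1}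

/-- The set `𝔹_m(t)`, for tuples indexed by a finite type `ι` with `m` elements. -/
def BSet (ι : Type) [Fintype ι] (t : ℂ) : Set (ι → OnePoint ℂ) :=
  {v | (∀ i, v i ∈ params) ∧ (∑ i, recip (v i) = t ∨ 1 ≤ ‖t - ∑ i, recip (v i)‖)}

/-- The conditions that make `(z₁, …, z_n; w)` transportable, for a given `j`. -/
def TransportableAt {n : ℕ} (z : Fin n → List ℂ) (w : List ℂ) (j : Fin n) : Prop :=
  ∀ J : Finset (Fin n), J.Nonempty → j ∉ J →
    (∀ a : (i : J) → Fin (z i).length, ∀ t ∈ w,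
      (fun i : J => (((z i).get (a i) : ℂ) : OnePoint ℂ)) ∈ BSet J t) ∧
    (∀ t ∈ w, ‖t‖ = 1 → ∀ i, i ≠ j → ∀ z₁ ∈ (z i).head?, ‖t - 1 / z₁‖ ≠ 1)

/-- `(z₁, …, z_n; w)` is transportable. -/
def Transportable {n : ℕ} (z : Fin n → List ℂ) (w : List ℂ) : Prop :=
  ∃ j, TransportableAt z w j

open Classical in
/-- The tuple `w` of variables of `W` if its index is `(1, …, 1)`, and `(w, 0)` otherwise. -/
def extVars (W : VarIndex) : List ℂ := if AllOnes W then vars W else vars W ++ [0]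

/-! ### Arrows -/

/-- Add `1` to the last entry of the index; the empty index is unchanged. -/
def up : VarIndex → VarIndex
  | [] => []
  | [(z, k)] => [(z, k + 1)]
  | c :: d :: A => c :: up (d :: A)

/-- The arrow labelled `v` on one of the first `n` components, up to its sign `arrowSign v`. -/
def arrow (A : VarIndex) : OnePoint ℂ → VarIndex
  | ∞ => up A
  | (z : ℂ) => A ++ [(z, 1)]

/-- The sign of the arrow labelled `v`. -/
def arrowSign : OnePoint ℂ → ℤ
  | ∞ => -1
  | (_ : ℂ) => 1

open Classical in
/-- The arrow labelled `t ∈ 𝔻` on the component to the right of the bar. -/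
def rightArrow (W : VarIndex) (t : ℂ) : VarIndex := if t = 0 then up W else W ++ [(t, 1)]

/-- The conditions under which the transport relation for `Z_{m+1}` may be applied to
`Z_{m+1}((A₁)_{→v₁}; …; (A_m)_{→v_m}; B | W_{→t})`; here `v'` is the label determined by
`1 / v' = t - ∑ i, 1 / v_i`. -/
structure CanTransport {m : ℕ} (A : Fin m → VarIndex) (v : Fin m → OnePoint ℂ) (B : VarIndex)
    (v' : OnePoint ℂ) (W : VarIndex) (t : ℂ) : Prop where
  one_le : 1 ≤ m
  valid : ∀ i, Valid (A i)
  valid_last : Valid B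
  valid_right : Valid W
  norm_le : ‖t‖ ≤ 1
  mem : v ∈ BSet (Fin m) t
  last_mem : v' ∈ params
  last_eq : recip v' = t - ∑ i, recip (v i)
  ne_infty : ∀ i, A i = [] → v i ≠ ∞
  ne_sum : B = [] → ∑ i, recip (v i) ≠ t
  two_first : m = 1 → ‖t‖ = 1 → ∀ i, A i = [] → ‖t - recip (v i)‖ ≠ 1
  two_last : m = 1 → ‖t‖ = 1 → B = [] → ∀ i, ‖recip (v i)‖ ≠ 1

/-! ### The boundary condition -/

/-- Splits a sum over `q₁ ≤ q₂ ≤ ⋯ ≤ q_s` into sums over strictly increasing chains, according to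
which neighbours are equal. -/
def strictify : VarIndex → List VarIndex
  | [] => []
  | [c] => [[c]]
  | (w, l) :: (w', l') :: W =>
      (strictify ((w', l') :: W)).map (fun X => (w, l) :: X) ++ strictify ((w, l + l') :: W)
  termination_by W => W.length

/-- The harmonic product of truncated sums over `m₁ < ⋯ < m_r` and `q₁ < ⋯ < q_s` with a common
last summation variable `m_r = q_s`, expressed in the shuffle-type variables. -/
def harmonicProduct : VarIndex → VarIndex → List VarIndex
  | [], _ => []
  | _ :: _, [] => []
  | [(z, k)], [(w, l)] => [[(z * w, k + l - 1)]]
  | [(z, k)], (w, l) :: d :: W =>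
      (harmonicProduct [(z, k)] (d :: W)).map (fun X => (z * w, l) :: X)
  | (z, k) :: c :: A, [(w, l)] =>
      (harmonicProduct (c :: A) [(w, l)]).map (fun X => (z * w, k) :: X)
  | (z, k) :: c :: A, (w, l) :: d :: W =>
      (harmonicProduct (c :: A) ((w, l) :: d :: W)).map (fun X => (z * w, k) :: X) ++
      (harmonicProduct ((z, k) :: c :: A) (d :: W)).map (fun X => (z * w, l) :: X) ++
      (harmonicProduct (c :: A) (d :: W)).map (fun X => (z * w, k + l) :: X)
  termination_by A W => A.length + W.length

/-- The combination of multiple polylogarithms which the boundary condition gives for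
`Z_1(B | W)`. -/
def boundary (B W : VarIndex) : VarIndex →₀ ℤ :=
  (((strictify W).flatMap (harmonicProduct B)).map fun X => Finsupp.single X 1).sum

/-! ### The recipe -/

/-- `Recipe A B W c`: the evaluation procedure, applied to `Z_{m+1}(A₁; …; A_m; B | W)`, may end
with the formal `ℤ`-linear combination `c` of multiple polylogarithms. -/
inductive Recipe : {m : ℕ} → (Fin m → VarIndex) → VarIndex → VarIndex → (VarIndex →₀ ℤ) → Prop
  /-- The transport relation
  `Z(…, (A_i)_{→v_i}, …; B | W_{→t})
    = - ∑ i, Z(…, A_i, …; B_{→v'} | W_{→t}) - Z(…, (A_i)_{→v_i}, …; B_{→v'} | W)`,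
  where the signs of the arrows labelled `∞` have been moved to the coefficients. -/
  | transport {m : ℕ} {A : Fin m → VarIndex} {v : Fin m → OnePoint ℂ} {B : VarIndex}
      {v' : OnePoint ℂ} {W : VarIndex} {t : ℂ} {c : Fin m → VarIndex →₀ ℤ} {c₀ : VarIndex →₀ ℤ}
      (h : CanTransport A v B v' W t)
      (hc : ∀ i, Recipe (Function.update (fun l => arrow (A l) (v l)) i (A i)) (arrow B v')
        (rightArrow W t) (c i))
      (hc₀ : Recipe (fun l => arrow (A l) (v l)) (arrow B v') W c₀) :
      Recipe (fun l => arrow (A l) (v l)) B (rightArrow W t)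
        (-(∑ i, (arrowSign (v i) * arrowSign v') • c i) - arrowSign v' • c₀)
  /-- An empty component may be omitted. -/
  | drop {m : ℕ} {A : Fin (m + 1) → VarIndex} {B W : VarIndex} {c : VarIndex →₀ ℤ}
      (i : Fin (m + 1)) (hi : A i = []) (hc : Recipe (fun l => A (i.succAbove l)) B W c) :
      Recipe A B W c
  /-- The sum is `0` if there is nothing to the right of the bar. -/
  | zero {m : ℕ} {A : Fin m → VarIndex} {B : VarIndex} : Recipe A B [] 0
  /-- A last column `(0 over 1)` to the right of the bar is the arrow labelled `0`. -/
  | zeroColumn {m : ℕ} {A : Fin m → VarIndex} {B W : VarIndex} {c : VarIndex →₀ ℤ}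
      (hc : Recipe A B (up W) c) : Recipe A B (W ++ [(0, 1)]) c
  /-- The boundary condition for an absolutely convergent `Z_1(B | W)`. -/
  | boundary {A : Fin 0 → VarIndex} {B W : VarIndex} {z w : ℂ} {k l : ℕ}
      (h : k = 1 → l = 1 → ‖z‖ < 1 ∨ ‖w‖ < 1) :
      Recipe A (B ++ [(z, k)]) (W ++ [(w, l)])
        (ConnectedSum.boundary (B ++ [(z, k)]) (W ++ [(w, l)]))

end

end ConnectedSum

open ConnectedSum

/-! Group each connected sum by the tuple `a` of last entries of its chains, with N = ∑ a_i. The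
group factors into the connector, one finite chain sum per component, and N times a weak chain sum
(`slice`, `sum_sliceFin`). The chain sums are formed through a multiplicative map φ, taken to be the
identity or the absolute value, so that one computation serves both for values and for absolute
convergence.

Convergence. A sum over chains with last entry m is O((m+1)^(ε-1)) for every ε in (0,1]. If two last
entries are positive, the multinomial coefficient is at least N, so the connector absorbs the factor
N, and the decay in N can be shared among the a_i (`summable_slice_of_two`).

Transport. An arrow labelled v, with its sign, turns a chain sum f into F with (1/v)(a+1)F(a+1) =
aF(a) + f(a). Raising a_i by one multiplies the connector by (a_i+1)/(N+1). If the numbers 1/v_i add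
up to t, these two facts give a recursion in N which, paired with the recursion of the weak sum on
the right, telescopes. The end term has a limit, and that limit is 0 because the same term divided
by N is summable (`tsum_transport`). The result is a relation symmetric in all components
(`sum_Z_transport`); solving it for one summand gives the transport relation.

Boundary. For one component the connector is 1, and the product of a strict and a weak chain sum
expands into strict chain sums (`sum_strictify`, `sum_harmonicProduct`).

Soundness (`Recipe.sound`) is an induction over the recipe. Existence (`exists_recipe`) is an
induction on the total weight outside the last component; transportability keeps every step
permitted. When the recipe is not available, the first claim still holds, because every complex
number is an integral multiple of some convergent Li₁(z) (`exists_evalLi_eq`). -/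

namespace ConnectedSum

noncomputable section

/-! ### Chain sums, the boundary condition and absolute convergence. -/

section Sums

open Finset

/-! ### Sums over chains with prescribed end points -/

section ChainSums

variable {R : Type*} [Field R] (φ : ℂ →*₀ R)

/-- The sum of `∏ z_i ^ (m_i - m_{i-1}) / m_i ^ k_i` over `p = m₀ < m₁ < ⋯ < m_r = m`, with the
variables mapped by `φ`. -/
def strictSum : VarIndex → ℕ → ℕ → R
  | [], p, m => if p = m then 1 else 0
  | c :: A, p, m => ∑ x ∈ Ioc p m, φ c.1 ^ (x - p) / (x : R) ^ c.2 * strictSum A x m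

/-- The sum over `p = q₀ ≤ q₁ ≤ ⋯ ≤ q_s = m`. -/
def weakTail : VarIndex → ℕ → ℕ → R
  | [], p, m => if p = m then 1 else 0
  | c :: A, p, m => ∑ x ∈ Icc p m, φ c.1 ^ (x - p) / (x : R) ^ c.2 * weakTail A x m

/-- The sum over `p = q₀ < q₁ ≤ ⋯ ≤ q_s = m`. -/
def weakSum : VarIndex → ℕ → ℕ → R
  | [], p, m => if p = m then 1 else 0
  | c :: A, p, m => ∑ x ∈ Ioc p m, φ c.1 ^ (x - p) / (x : R) ^ c.2 * weakTail φ A x m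

/-- The connector, with values in an arbitrary field. -/
def conn (R : Type*) [Field R] {ι : Type*} [Fintype ι] (a : ι → ℕ) : R :=
  (∏ i, ((a i).factorial : R)) / ((∑ i, a i).factorial : R)

/-- The part of a connected sum with prescribed last entries `a` of the chains. -/
def slice {ι : Type*} [Fintype ι] (A : ι → VarIndex) (W : VarIndex) (a : ι → ℕ) : R :=
  conn R a * (∏ i, strictSum φ (A i) 0 (a i)) *
    (((∑ i, a i : ℕ) : R) * weakSum φ W 0 (∑ i, a i))

theorem strictSum_self {A : VarIndex} (hA : A ≠ []) (p : ℕ) : strictSum φ A p p = 0 := by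
  cases A with
  | nil => exact absurd rfl hA
  | cons c A => simp [strictSum]

/-- With nothing to the right of the bar only N = 0 is possible, and there the factor N vanishes.
This agrees with the convention that such a `Z` is 0. -/
theorem slice_nil {ι : Type*} [Fintype ι] (A : ι → VarIndex) (a : ι → ℕ) :
    slice φ A [] a = 0 := by
  by_cases h : ∑ i, a i = 0
  · simp [slice, h]
  · simp [slice, weakSum, Ne.symm h]

end ChainSums

/-! ### Finite sets of chains -/

/-- The chains `p = m₀ < m₁ < ⋯ < m_r = N`. -/
def strictFin : (r p N : ℕ) → Finset (Fin (r + 1) → ℕ)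
  | 0, p, N => if p = N then {fun _ => p} else ∅
  | r + 1, p, N => (Ioc p N).biUnion fun x =>
      (strictFin r x N).map
        ⟨fun m => (Fin.cons p m : Fin (r + 2) → ℕ), Fin.cons_right_injective (α := fun _ : Fin (r + 2) => ℕ) p⟩

/-- The chains `p = q₀ ≤ q₁ ≤ ⋯ ≤ q_s = N`. -/
def weakTailFin : (r p N : ℕ) → Finset (Fin (r + 1) → ℕ)
  | 0, p, N => if p = N then {fun _ => p} else ∅
  | r + 1, p, N => (Icc p N).biUnion fun x =>
      (weakTailFin r x N).map
        ⟨fun m => (Fin.cons p m : Fin (r + 2) → ℕ), Fin.cons_right_injective (α := fun _ : Fin (r + 2) => ℕ) p⟩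

/-- The chains `p = q₀ < q₁ ≤ ⋯ ≤ q_s = N`. -/
def weakFin : (r p N : ℕ) → Finset (Fin (r + 1) → ℕ)
  | 0, p, N => if p = N then {fun _ => p} else ∅
  | r + 1, p, N => (Ioc p N).biUnion fun x =>
      (weakTailFin r x N).map
        ⟨fun m => (Fin.cons p m : Fin (r + 2) → ℕ), Fin.cons_right_injective (α := fun _ : Fin (r + 2) => ℕ) p⟩

theorem mem_strictFin {r p N : ℕ} {m : Fin (r + 1) → ℕ} :
    m ∈ strictFin r p N ↔ m 0 = p ∧ StrictMono m ∧ m (Fin.last r) = N := by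
  induction r generalizing p with
  | zero =>
    have : Subsingleton (Fin (0 + 1)) := inferInstanceAs (Subsingleton (Fin 1))
    have h0 : StrictMono m := Subsingleton.strictMono m
    have h1 : ∀ q : ℕ, m = (fun _ => q) ↔ m 0 = q := fun q =>
      ⟨fun h => by rw [h], fun h => funext fun i => by rw [Subsingleton.elim i 0, h]⟩
    rw [strictFin]
    split_ifs with h
    · subst h; simp [h1, h0]
    · simp only [notMem_empty, false_iff, not_and]
      intro h2 _ h3; exact h (h2.symm.trans h3)
  | succ r ih =>
    simp only [strictFin, mem_biUnion, mem_map, ih, Function.Embedding.coeFn_mk, mem_Ioc]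
    constructor
    · rintro ⟨x, ⟨hx1, hx2⟩, m', ⟨h0, hm, hl⟩, rfl⟩
      refine ⟨rfl, ?_, ?_⟩
      · rw [Fin.strictMono_iff_lt_succ]
        intro i
        refine Fin.cases ?_ (fun i => ?_) i
        · simpa [h0] using hx1
        · rw [← Fin.succ_castSucc, Fin.cons_succ, Fin.cons_succ]
          exact hm Fin.castSucc_lt_succ
      · rw [← Fin.succ_last, Fin.cons_succ, hl]
    · rintro ⟨h0, hm, hl⟩
      refine ⟨m 1, ⟨?_, ?_⟩, Fin.tail m, ⟨rfl, ?_, ?_⟩, ?_⟩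
      · rw [← h0]; exact hm (by simp)
      · rw [← hl]; exact hm.monotone (Fin.le_last _)
      · exact fun i j hij => hm (Fin.succ_lt_succ_iff.2 hij)
      · rw [← hl]; rfl
      · rw [← h0]; exact Fin.cons_self_tail m

theorem mem_weakTailFin {r p N : ℕ} {m : Fin (r + 1) → ℕ} :
    m ∈ weakTailFin r p N ↔ m 0 = p ∧ Monotone m ∧ m (Fin.last r) = N := by
  induction r generalizing p with
  | zero =>
    have : Subsingleton (Fin (0 + 1)) := inferInstanceAs (Subsingleton (Fin 1))
    have h0 : Monotone m := Subsingleton.monotone m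
    have h1 : ∀ q : ℕ, m = (fun _ => q) ↔ m 0 = q := fun q =>
      ⟨fun h => by rw [h], fun h => funext fun i => by rw [Subsingleton.elim i 0, h]⟩
    rw [weakTailFin]
    split_ifs with h
    · subst h; simp [h1, h0]
    · simp only [notMem_empty, false_iff, not_and]
      intro h2 _ h3; exact h (h2.symm.trans h3)
  | succ r ih =>
    simp only [weakTailFin, mem_biUnion, mem_map, ih, Function.Embedding.coeFn_mk, mem_Icc]
    constructor
    · rintro ⟨x, ⟨hx1, hx2⟩, m', ⟨h0, hm, hl⟩, rfl⟩
      refine ⟨rfl, ?_, ?_⟩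
      · rw [Fin.monotone_iff_le_succ]
        intro i
        refine Fin.cases ?_ (fun i => ?_) i
        · simpa [h0] using hx1
        · rw [← Fin.succ_castSucc, Fin.cons_succ, Fin.cons_succ]
          exact hm (Fin.castSucc_le_succ _)
      · rw [← Fin.succ_last, Fin.cons_succ, hl]
    · rintro ⟨h0, hm, hl⟩
      refine ⟨m 1, ⟨?_, ?_⟩, Fin.tail m, ⟨rfl, ?_, ?_⟩, ?_⟩
      · rw [← h0]; exact hm (by simp)
      · rw [← hl]; exact hm (Fin.le_last _)
      · exact fun i j hij => hm (Fin.succ_le_succ_iff.2 hij)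
      · rw [← hl]; rfl
      · rw [← h0]; exact Fin.cons_self_tail m

theorem mem_weakFin {r N : ℕ} {m : Fin (r + 1) → ℕ} :
    m ∈ weakFin r 0 N ↔ m ∈ weakChains r N := by
  cases r with
  | zero =>
    have : Subsingleton (Fin (0 + 1)) := inferInstanceAs (Subsingleton (Fin 1))
    have h0 : Monotone m := Subsingleton.monotone m
    have h1 : ∀ q : ℕ, m = (fun _ => q) ↔ m 0 = q := fun q =>
      ⟨fun h => by rw [h], fun h => funext fun i => by rw [Subsingleton.elim i 0, h]⟩
    rw [weakFin]
    have h2 : ∀ i : Fin 1, i ≠ 0 → 0 < m i := fun i hi => absurd (Subsingleton.elim i 0) hi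
    split_ifs with h
    · subst h
      rw [mem_singleton, h1]
      exact ⟨fun h => ⟨h, h2, h0, h⟩, fun h => h.1⟩
    · simp only [notMem_empty, false_iff]
      intro h3; exact h (h3.1.symm.trans h3.2.2.2)
  | succ r =>
    simp only [weakFin, mem_biUnion, mem_map, mem_weakTailFin, Function.Embedding.coeFn_mk,
      mem_Ioc]
    constructor
    · rintro ⟨x, ⟨hx1, hx2⟩, m', ⟨h0, hm, hl⟩, rfl⟩
      refine ⟨rfl, ?_, ?_, ?_⟩
      · intro i hi
        obtain ⟨i, rfl⟩ := Fin.exists_succ_eq.2 hi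
        rw [Fin.cons_succ]
        exact hx1.trans_le (h0 ▸ hm (Fin.zero_le _))
      · rw [Fin.monotone_iff_le_succ]
        intro i
        refine Fin.cases ?_ (fun i => ?_) i
        · simp
        · rw [← Fin.succ_castSucc, Fin.cons_succ, Fin.cons_succ]
          exact hm (Fin.castSucc_le_succ _)
      · rw [← Fin.succ_last, Fin.cons_succ, hl]
    · rintro ⟨h0, hp, hm, hl⟩
      refine ⟨m 1, ⟨hp 1 (by simp), ?_⟩, Fin.tail m, ⟨rfl, ?_, ?_⟩, ?_⟩
      · rw [← hl]; exact hm (Fin.le_last _)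
      · exact fun i j hij => hm (Fin.succ_le_succ_iff.2 hij)
      · rw [← hl]; rfl
      · rw [← h0]; exact Fin.cons_self_tail m

section Link

variable {R : Type*} [Field R] {φ : ℂ →*₀ R}

theorem chainTerm_cons (hφ : ∀ n : ℕ, φ n = n) (c : ℂ × ℕ) (A : VarIndex) (p : ℕ)
    (m : Fin (A.length + 1) → ℕ) :
    φ (chainTerm (c :: A) (Fin.cons p m : Fin (A.length + 2) → ℕ)) =
      φ c.1 ^ (m 0 - p) / (m 0 : R) ^ c.2 * φ (chainTerm A m) := by
  have : chainTerm (c :: A) (Fin.cons p m : Fin (A.length + 2) → ℕ) =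
      c.1 ^ (m 0 - p) / (m 0 : ℂ) ^ c.2 * chainTerm A m := by
    unfold chainTerm
    exact Fin.prod_univ_succ _
  rw [this, map_mul, map_div₀, map_pow, map_pow, hφ]

theorem sum_strictFin (hφ : ∀ n : ℕ, φ n = n) (A : VarIndex) (p N : ℕ) :
    ∑ m ∈ strictFin A.length p N, φ (chainTerm A m) = strictSum φ A p N := by
  induction A generalizing p with
  | nil =>
    simp only [List.length_nil, strictFin, strictSum]
    split_ifs <;> simp [chainTerm]
  | cons c A ih =>
    simp only [List.length_cons, strictFin, strictSum]
    rw [sum_biUnion]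
    · refine sum_congr rfl fun x hx => ?_
      rw [sum_map, ← ih, mul_sum]
      refine sum_congr rfl fun m hm => ?_
      rw [mem_strictFin] at hm
      exact (chainTerm_cons hφ c A p m).trans (by rw [hm.1])
    · intro x _ y _ hxy
      simp only [Function.onFun, disjoint_left, mem_map, not_exists, not_and,
        forall_exists_index, and_imp, mem_strictFin, Function.Embedding.coeFn_mk]
      rintro _ m h1 h2 h3 rfl m' h4 h5 h6 h7
      have h8 : m' 0 = m 0 := congrFun h7 1
      exact hxy (h1.symm.trans (h8.symm.trans h4))

theorem sum_weakTailFin (hφ : ∀ n : ℕ, φ n = n) (A : VarIndex) (p N : ℕ) :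
    ∑ m ∈ weakTailFin A.length p N, φ (chainTerm A m) = weakTail φ A p N := by
  induction A generalizing p with
  | nil =>
    simp only [List.length_nil, weakTailFin, weakTail]
    split_ifs <;> simp [chainTerm]
  | cons c A ih =>
    simp only [List.length_cons, weakTailFin, weakTail]
    rw [sum_biUnion]
    · refine sum_congr rfl fun x hx => ?_
      rw [sum_map, ← ih, mul_sum]
      refine sum_congr rfl fun m hm => ?_
      rw [mem_weakTailFin] at hm
      exact (chainTerm_cons hφ c A p m).trans (by rw [hm.1])
    · intro x _ y _ hxy
      simp only [Function.onFun, disjoint_left, mem_map, not_exists, not_and,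
        forall_exists_index, and_imp, mem_weakTailFin, Function.Embedding.coeFn_mk]
      rintro _ m h1 h2 h3 rfl m' h4 h5 h6 h7
      have h8 : m' 0 = m 0 := congrFun h7 1
      exact hxy (h1.symm.trans (h8.symm.trans h4))

theorem sum_weakFin (hφ : ∀ n : ℕ, φ n = n) (A : VarIndex) (p N : ℕ) :
    ∑ m ∈ weakFin A.length p N, φ (chainTerm A m) = weakSum φ A p N := by
  cases A with
  | nil =>
    simp only [List.length_nil, weakFin, weakSum]
    split_ifs <;> simp [chainTerm]
  | cons c A =>
    simp only [List.length_cons, weakFin, weakSum]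
    rw [sum_biUnion]
    · refine sum_congr rfl fun x hx => ?_
      rw [sum_map, ← sum_weakTailFin hφ, mul_sum]
      refine sum_congr rfl fun m hm => ?_
      rw [mem_weakTailFin] at hm
      exact (chainTerm_cons hφ c A p m).trans (by rw [hm.1])
    · intro x _ y _ hxy
      simp only [Function.onFun, disjoint_left, mem_map, not_exists, not_and,
        forall_exists_index, and_imp, mem_weakTailFin, Function.Embedding.coeFn_mk]
      rintro _ m h1 h2 h3 rfl m' h4 h5 h6 h7
      have h8 : m' 0 = m 0 := congrFun h7 1
      exact hxy (h1.symm.trans (h8.symm.trans h4))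

/-- The tuples of chains in a connected sum with prescribed last entries. -/
def sliceFin {n : ℕ} (A : Fin n → VarIndex) (W : VarIndex) (a : Fin n → ℕ) :
    Finset (((j : Fin n) → Fin ((A j).length + 1) → ℕ) × (Fin (W.length + 1) → ℕ)) :=
  Fintype.piFinset (fun j => strictFin (A j).length 0 (a j)) ×ˢ weakFin W.length 0 (∑ j, a j)

theorem mem_sliceFin {n : ℕ} {A : Fin n → VarIndex} {W : VarIndex} {a : Fin n → ℕ}
    {p : ((j : Fin n) → Fin ((A j).length + 1) → ℕ) × (Fin (W.length + 1) → ℕ)} :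
    p ∈ sliceFin A W a ↔ p ∈ summationSet A W ∧ (fun j => p.1 j (Fin.last _)) = a := by
  simp only [sliceFin, mem_product, Fintype.mem_piFinset, mem_strictFin, mem_weakFin,
    summationSet, Set.mem_ofPred_eq, strictChains]
  constructor
  · rintro ⟨h1, h2⟩
    have h3 : (fun j => p.1 j (Fin.last _)) = a := funext fun j => (h1 j).2.2
    refine ⟨⟨fun j => ⟨(h1 j).1, (h1 j).2.1⟩, ?_⟩, h3⟩
    subst h3; exact h2
  · rintro ⟨⟨h1, h2⟩, rfl⟩
    exact ⟨fun j => ⟨(h1 j).1, (h1 j).2, rfl⟩, h2⟩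

/-- Once the last entries are fixed, the chains vary independently of one another, so the sum of
products is a product of sums. -/
theorem sum_sliceFin (hφ : ∀ n : ℕ, φ n = n) {n : ℕ} (A : Fin n → VarIndex) (W : VarIndex)
    (a : Fin n → ℕ) : ∑ p ∈ sliceFin A W a, φ (connTerm A W p) = slice φ A W a := by
  have key : ∀ p ∈ sliceFin A W a, φ (connTerm A W p) =
      (conn R a * ((∑ i, a i : ℕ) : R)) *
        ((∏ j, φ (chainTerm (A j) (p.1 j))) * φ (chainTerm W p.2)) := by
    intro p hp
    obtain ⟨hp1, rfl⟩ := mem_sliceFin.1 hp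
    rw [connTerm, hp1.2.2.2.2, connector, conn]
    simp only [map_mul, map_div₀, map_prod, hφ]
    ring
  rw [sum_congr rfl key, ← mul_sum, sliceFin, sum_product]
  simp only [← mul_sum, ← sum_mul, sum_weakFin hφ]
  rw [← prod_univ_sum (fun j => strictFin (A j).length 0 (a j))
    (fun j m => φ (chainTerm (A j) m))]
  simp only [sum_strictFin hφ, slice]
  ring

end Link

/-! ### Summation over finite fibres -/

/-- The inner sums are finite and the terms nonnegative, so only the outer sum over `a` can fail to
converge. -/
theorem summable_fibre {α β : Type*} {S : Set β} {F : α → Finset β} (π : β → α)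
    (hF : ∀ a b, b ∈ F a ↔ b ∈ S ∧ π b = a) (f : β → ℝ) (hf : ∀ b, 0 ≤ f b) :
    (Summable fun b : S => f b) ↔ Summable fun a => ∑ b ∈ F a, f b := by
  let e : (Σ a, F a) ≃ S :=
    { toFun := fun x => ⟨x.2, ((hF _ _).1 x.2.2).1⟩
      invFun := fun b => ⟨π b, b, (hF _ _).2 ⟨b.2, rfl⟩⟩
      left_inv := by
        rintro ⟨a, b, hb⟩
        obtain ⟨_, rfl⟩ := (hF _ _).1 hb
        rfl
      right_inv := fun b => rfl }
  rw [← e.summable_iff, Function.comp_def, summable_sigma_of_nonneg (fun _ => hf _)]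
  simp only [tsum_fintype]
  refine ⟨fun h => ?_, fun h => ⟨fun a => (hasSum_fintype _).summable, ?_⟩⟩
  · refine h.2.congr fun a => ?_
    exact (sum_coe_sort (F a) f)
  · refine h.congr fun a => ?_
    exact (sum_coe_sort (F a) f).symm

theorem tsum_fibre {α β : Type*} {S : Set β} {F : α → Finset β} (π : β → α)
    (hF : ∀ a b, b ∈ F a ↔ b ∈ S ∧ π b = a) (f : β → ℂ) (hf : Summable fun b : S => f b) :
    ∑' b : S, f b = ∑' a, ∑ b ∈ F a, f b := by
  let e : (Σ a, F a) ≃ S :=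
    { toFun := fun x => ⟨x.2, ((hF _ _).1 x.2.2).1⟩
      invFun := fun b => ⟨π b, b, (hF _ _).2 ⟨b.2, rfl⟩⟩
      left_inv := by
        rintro ⟨a, b, hb⟩
        obtain ⟨_, rfl⟩ := (hF _ _).1 hb
        rfl
      right_inv := fun b => rfl }
  rw [← e.tsum_eq]
  have h := e.summable_iff.2 hf
  rw [Function.comp_def] at h
  rw [h.tsum_sigma]
  refine tsum_congr fun a => ?_
  rw [tsum_fintype]
  exact (sum_coe_sort (F a) f)

/-- The absolute value as a multiplicative map. -/
abbrev absHom : ℂ →*₀ ℝ := normHom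

/-- The identity of `ℂ` as a multiplicative map. -/
abbrev idHom : ℂ →*₀ ℂ := MonoidWithZeroHom.id ℂ

theorem absHom_natCast (n : ℕ) : absHom (n : ℂ) = n := by simp [absHom, normHom]

theorem idHom_natCast (n : ℕ) : idHom (n : ℂ) = n := rfl

theorem summable_connTerm_iff {n : ℕ} (A : Fin n → VarIndex) (W : VarIndex) :
    (Summable fun p : summationSet A W => ‖connTerm A W p‖) ↔ Summable (slice absHom A W) := by
  rw [summable_fibre (F := sliceFin A W) (fun p j => p.1 j (Fin.last _))
    (fun a b => mem_sliceFin) (fun p => ‖connTerm A W p‖) (fun _ => norm_nonneg _)]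
  refine Eq.to_iff (congrArg Summable (funext fun a => ?_))
  exact sum_sliceFin absHom_natCast A W a

theorem Z_eq_tsum {n : ℕ} {A : Fin n → VarIndex} {W : VarIndex}
    (h : Summable (slice absHom A W)) : Z A W = ∑' a, slice idHom A W a := by
  rw [Z]
  split_ifs with hW
  · subst hW; simp [slice_nil]
  · have h' := ((summable_connTerm_iff A W).2 h).of_norm
    rw [tsum_fibre (F := sliceFin A W) (fun p j => p.1 j (Fin.last _))
      (fun a b => mem_sliceFin) (connTerm A W) h']
    exact tsum_congr fun a => sum_sliceFin idHom_natCast A W a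

theorem mem_strictFin_iff (r N : ℕ) (m : Fin (r + 1) → ℕ) :
    m ∈ strictFin r 0 N ↔ m ∈ strictChains r ∧ m (Fin.last r) = N := by
  rw [mem_strictFin, strictChains, Set.mem_ofPred_eq, and_assoc]

theorem summable_chainTerm_iff (A : VarIndex) :
    (Summable fun m : strictChains A.length => ‖chainTerm A m‖) ↔
      Summable (strictSum absHom A 0) := by
  rw [summable_fibre (F := strictFin A.length 0) (fun m => m (Fin.last _))
    (fun a b => mem_strictFin_iff _ _ _) (fun m => ‖chainTerm A m‖) (fun _ => norm_nonneg _)]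
  refine Eq.to_iff (congrArg Summable (funext fun a => ?_))
  exact sum_strictFin absHom_natCast A 0 a

theorem Li_eq_tsum {A : VarIndex} (h : Summable (strictSum absHom A 0)) :
    Li A = ∑' N, strictSum idHom A 0 N := by
  have h' := ((summable_chainTerm_iff A).2 h).of_norm
  rw [Li, tsum_fibre (F := strictFin A.length 0) (fun m => m (Fin.last _))
      (fun a b => mem_strictFin_iff _ _ _) (chainTerm A) h']
  exact tsum_congr fun a => sum_strictFin idHom_natCast A 0 a

/-! ### Comparison of the sums with their absolute values -/

theorem norm_strictSum_le (A : VarIndex) (p m : ℕ) :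
    ‖strictSum idHom A p m‖ ≤ strictSum absHom A p m := by
  rw [← sum_strictFin idHom_natCast, ← sum_strictFin absHom_natCast]
  exact norm_sum_le _ _

theorem norm_slice_le {n : ℕ} (A : Fin n → VarIndex) (W : VarIndex) (a : Fin n → ℕ) :
    ‖slice idHom A W a‖ ≤ slice absHom A W a := by
  rw [← sum_sliceFin idHom_natCast, ← sum_sliceFin absHom_natCast]
  exact norm_sum_le _ _

theorem summable_slice {n : ℕ} {A : Fin n → VarIndex} {W : VarIndex}
    (h : Summable (slice absHom A W)) : Summable (slice idHom A W) :=
  Summable.of_norm_bounded h (norm_slice_le A W)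

theorem strictSum_nonneg (A : VarIndex) (p m : ℕ) : 0 ≤ strictSum absHom A p m :=
  (norm_nonneg _).trans (norm_strictSum_le A p m)

theorem norm_weakSum_le (A : VarIndex) (p m : ℕ) :
    ‖weakSum idHom A p m‖ ≤ weakSum absHom A p m := by
  rw [← sum_weakFin idHom_natCast, ← sum_weakFin absHom_natCast]
  exact norm_sum_le _ _

theorem weakSum_nonneg (A : VarIndex) (p m : ℕ) : 0 ≤ weakSum absHom A p m :=
  (norm_nonneg _).trans (norm_weakSum_le A p m)

theorem slice_nonneg {n : ℕ} (A : Fin n → VarIndex) (W : VarIndex) (a : Fin n → ℕ) :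
    0 ≤ slice absHom A W a :=
  (norm_nonneg _).trans (norm_slice_le A W a)

/-! ### Appending columns -/

section Append

variable {R : Type*} [Field R] (φ : ℂ →*₀ R)

/-- Interchanging summations moves the recursion from the first column to the last one, which is
where arrows act. -/
theorem strictSum_append (A : VarIndex) (c : ℂ × ℕ) (p m : ℕ) :
    strictSum φ (A ++ [c]) p m =
      (∑ x ∈ Ico p m, strictSum φ A p x * φ c.1 ^ (m - x)) / (m : R) ^ c.2 := by
  induction A generalizing p with
  | nil =>
    rcases lt_or_ge p m with h | h
    · simp [strictSum, h]
    · simp [strictSum, h]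
  | cons d A ih =>
    simp only [List.cons_append, strictSum, ih]
    rw [sum_div]
    simp only [mul_div_assoc', mul_sum, sum_mul, sum_div]
    rw [sum_comm' (t' := Ico p m) (s' := fun x => Ioc p x)]
    · refine sum_congr rfl fun x _ => ?_
      refine sum_congr rfl fun y _ => ?_
      ring
    · intro x y
      simp only [mem_Ioc, mem_Ico]
      omega

theorem weakTail_append (A : VarIndex) (c : ℂ × ℕ) (p m : ℕ) :
    weakTail φ (A ++ [c]) p m =
      (∑ x ∈ Icc p m, weakTail φ A p x * φ c.1 ^ (m - x)) / (m : R) ^ c.2 := by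
  induction A generalizing p with
  | nil =>
    rcases le_or_gt p m with h | h
    · simp [weakTail, h]
    · simp [weakTail, h]
  | cons d A ih =>
    simp only [List.cons_append, weakTail, ih]
    rw [sum_div]
    simp only [mul_div_assoc', mul_sum, sum_mul, sum_div]
    rw [sum_comm' (t' := Icc p m) (s' := fun x => Icc p x)]
    · refine sum_congr rfl fun x _ => ?_
      refine sum_congr rfl fun y _ => ?_
      ring
    · intro x y
      simp only [mem_Icc]
      omega

/-- Nonemptiness matters because the first step of a weak chain is strict: appended to the empty
index, the new column must not use x = m = p. -/
theorem weakSum_append {A : VarIndex} (hA : A ≠ []) (c : ℂ × ℕ) (p m : ℕ) :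
    weakSum φ (A ++ [c]) p m =
      (∑ x ∈ Icc p m, weakSum φ A p x * φ c.1 ^ (m - x)) / (m : R) ^ c.2 := by
  cases A with
  | nil => exact absurd rfl hA
  | cons d A =>
    simp only [List.cons_append, weakSum, weakTail_append]
    rw [sum_div]
    simp only [mul_div_assoc', mul_sum, sum_mul, sum_div]
    rw [sum_comm' (t' := Icc p m) (s' := fun x => Ioc p x)]
    · refine sum_congr rfl fun x _ => ?_
      refine sum_congr rfl fun y _ => ?_
      ring
    · intro x y
      simp only [mem_Icc, mem_Ioc]
      omega

theorem up_append (A : VarIndex) (z : ℂ) (k : ℕ) : up (A ++ [(z, k)]) = A ++ [(z, k + 1)] := by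
  induction A with
  | nil => rfl
  | cons c A ih =>
    cases A with
    | nil => rfl
    | cons d A => exact congrArg (c :: ·) ih

theorem strictSum_up {A : VarIndex} (hA : A ≠ []) (p m : ℕ) :
    strictSum φ (up A) p m = strictSum φ A p m / m := by
  obtain ⟨A, ⟨z, k⟩, rfl⟩ := (List.eq_nil_or_concat A).resolve_left hA
  rw [List.concat_eq_append, up_append, strictSum_append, strictSum_append, pow_succ, div_div]

theorem weakSum_up {A : VarIndex} (hA : A ≠ []) (p m : ℕ) :
    weakSum φ (up A) p m = weakSum φ A p m / m := by
  obtain ⟨A, ⟨z, k⟩, rfl⟩ := (List.eq_nil_or_concat A).resolve_left hA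
  rw [List.concat_eq_append, up_append]
  by_cases h : A = []
  · subst h
    rcases le_or_gt m p with h | h
    · simp [weakSum, h]
    · simp [weakSum, weakTail, h, pow_succ, div_div]
  · rw [weakSum_append φ h, weakSum_append φ h, pow_succ, div_div]

end Append

/-! ### Splitting weak chains and multiplying sums over chains -/

section Products

variable {R : Type*} [Field R] (φ : ℂ →*₀ R)

theorem strictSum_cons (c : ℂ × ℕ) (A : VarIndex) (p m : ℕ) :
    strictSum φ (c :: A) p m =
      ∑ x ∈ Ioc p m, φ c.1 ^ (x - p) / (x : R) ^ c.2 * strictSum φ A x m := rfl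

theorem list_sum_map_sum_mul {α : Type*} (L : List α) (s : Finset ℕ) (u : ℕ → R)
    (f : α → ℕ → R) :
    (L.map fun X => ∑ x ∈ s, u x * f X x).sum = ∑ x ∈ s, u x * (L.map fun X => f X x).sum := by
  induction L with
  | nil => simp
  | cons X L ih => simp [ih, mul_add, sum_add_distrib]

theorem weakTail_cons_eq (c : ℂ × ℕ) (W : VarIndex) {p m : ℕ} (h : p ≤ m) :
    weakTail φ (c :: W) p m =
      1 / (p : R) ^ c.2 * weakTail φ W p m + weakSum φ (c :: W) p m := by
  rw [weakTail, Icc_eq_cons_Ioc h, sum_cons, weakSum]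
  simp

/-- At the first two entries either q₁ < q₂, or q₁ = q₂; in the latter case the second variable has
exponent 0 and the denominators multiply, so the columns merge. -/
theorem sum_strictify (W : VarIndex) (hW : W ≠ []) (p m : ℕ) :
    ((strictify W).map fun X => strictSum φ X p m).sum = weakSum φ W p m := by
  induction W using strictify.induct generalizing p with
  | case1 => exact absurd rfl hW
  | case2 c => simp [strictify, strictSum, weakSum, weakTail]
  | case3 w l w' l' W ih1 ih2 =>
    rw [strictify, List.map_append, List.sum_append, ih2 (by simp), List.map_map]
    simp only [Function.comp_def, strictSum]
    rw [list_sum_map_sum_mul (u := fun x => φ w ^ (x - p) / (x : R) ^ l)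
      (f := fun X x => strictSum φ X x m)]
    simp only [ih1 (by simp), weakSum]
    rw [← sum_add_distrib]
    refine sum_congr rfl fun x hx => ?_
    rw [weakTail_cons_eq φ _ _ (mem_Ioc.1 hx).2, pow_add, weakSum]
    simp only [div_eq_mul_inv, mul_inv]
    ring

/-- The square of pairs (x, y) splits into x < y, y < x and x = y. -/
theorem sum_Ioc_mul_sum_Ioc (a b : ℕ → R) (p m : ℕ) :
    (∑ x ∈ Ioc p m, a x) * ∑ y ∈ Ioc p m, b y =
      (∑ x ∈ Ioc p m, a x * ∑ y ∈ Ioc x m, b y) + (∑ y ∈ Ioc p m, b y * ∑ x ∈ Ioc y m, a x) +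
        ∑ x ∈ Ioc p m, a x * b x := by
  have h2 : ∑ y ∈ Ioc p m, b y * ∑ x ∈ Ioc y m, a x =
      ∑ x ∈ Ioc p m, a x * ∑ y ∈ Ioo p x, b y := by
    simp only [mul_sum]
    rw [sum_comm' (t' := Ioc p m) (s' := fun x => Ioo p x)]
    · simp only [mul_comm]
    · intro x y
      simp only [mem_Ioc, mem_Ioo]
      omega
  rw [h2, sum_mul, ← sum_add_distrib, ← sum_add_distrib]
  refine sum_congr rfl fun x hx => ?_
  rw [mem_Ioc] at hx
  have h3 : Ioc p m = (Ioo p x ∪ {x}) ∪ Ioc x m := by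
    ext y; simp only [mem_Ioc, mem_Ioo, mem_union, mem_singleton]; omega
  rw [h3, sum_union, sum_union, sum_singleton]
  · ring
  · simp
  · rw [disjoint_left]
    intro y; simp only [mem_Ioc, mem_Ioo, mem_union, mem_singleton]; omega

/-- A power over (p, y] splits at x. The piece over (p, x] joins the power of the other chain, which
is why the variables of a common segment are multiplied. -/
theorem sum_Ioc_shift (c : ℂ × ℕ) (A : VarIndex) {p x m : ℕ} (h : p ≤ x) :
    ∑ y ∈ Ioc x m, φ c.1 ^ (y - p) / (y : R) ^ c.2 * strictSum φ A y m =
      φ c.1 ^ (x - p) * strictSum φ (c :: A) x m := by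
  rw [strictSum, mul_sum]
  refine sum_congr rfl fun y hy => ?_
  rw [mem_Ioc] at hy
  rw [show y - p = (x - p) + (y - x) by omega, pow_add]
  ring

theorem strictSum_mul_strictSum (c d : ℂ × ℕ) (A W : VarIndex) (p m : ℕ) :
    strictSum φ (c :: A) p m * strictSum φ (d :: W) p m =
      (∑ x ∈ Ioc p m, φ (c.1 * d.1) ^ (x - p) / (x : R) ^ c.2 *
        (strictSum φ A x m * strictSum φ (d :: W) x m)) +
      (∑ x ∈ Ioc p m, φ (c.1 * d.1) ^ (x - p) / (x : R) ^ d.2 *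
        (strictSum φ (c :: A) x m * strictSum φ W x m)) +
      ∑ x ∈ Ioc p m, φ (c.1 * d.1) ^ (x - p) / (x : R) ^ (c.2 + d.2) *
        (strictSum φ A x m * strictSum φ W x m) := by
  rw [strictSum, strictSum, sum_Ioc_mul_sum_Ioc]
  refine congrArg₂ _ (congrArg₂ _ ?_ ?_) ?_
  · refine sum_congr rfl fun x hx => ?_
    rw [sum_Ioc_shift φ d W (mem_Ioc.1 hx).1.le, map_mul, mul_pow]
    ring
  · refine sum_congr rfl fun x hx => ?_
    rw [sum_Ioc_shift φ c A (mem_Ioc.1 hx).1.le, map_mul, mul_pow]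
    ring
  · refine sum_congr rfl fun x hx => ?_
    rw [map_mul, mul_pow, pow_add]
    simp only [div_eq_mul_inv, mul_inv]
    ring

/-- An exhausted chain has already reached its end m, where a nonempty chain can no longer start.
This removes the interleavings without a common last entry. -/
theorem strictSum_nil_mul {A : VarIndex} (hA : A ≠ []) (p m : ℕ) :
    strictSum φ [] p m * strictSum φ A p m = 0 := by
  by_cases h : p = m
  · rw [h, strictSum_self φ hA, mul_zero]
  · simp [strictSum, h]

/-- The factor m cancels one power of the common last entry, whence the last exponent k + l - 1.
Earlier columns follow the trichotomy of `strictSum_mul_strictSum`. -/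
theorem sum_harmonicProduct [CharZero R] (A W : VarIndex) (hA : A ≠ []) (hW : W ≠ [])
    (hk : ∀ c ∈ A, 1 ≤ c.2) (p m : ℕ) :
    ((harmonicProduct A W).map fun X => strictSum φ X p m).sum =
      strictSum φ A p m * (m * strictSum φ W p m) := by
  rw [mul_left_comm]
  induction A, W using harmonicProduct.induct generalizing p with
  | case1 => exact absurd rfl hA
  | case2 => exact absurd rfl hW
  | case3 z k w l =>
    rcases le_or_gt m p with h | h
    · simp [harmonicProduct, strictSum, h]
    · have hm : (m : R) ≠ 0 := by
        rw [Nat.cast_ne_zero]; omega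
      -- Positivity of k makes the truncated subtraction in k + l - 1 a genuine one.
      obtain ⟨k, rfl⟩ : ∃ k', k = k' + 1 := ⟨k - 1, by have := hk (z, k) (by simp); omega⟩
      simp only [harmonicProduct, List.map_cons, List.map_nil, List.sum_cons, List.sum_nil,
        strictSum, mul_ite, mul_one, mul_zero, sum_ite_eq', mem_Ioc, h, le_refl, and_self, if_true,
        add_zero, map_mul, mul_pow]
      rw [show k + 1 + l - 1 = k + l by omega, pow_succ, pow_add]
      field_simp
  | case4 z k w l d W ih =>
    rw [harmonicProduct, List.map_map, strictSum_mul_strictSum]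
    simp only [Function.comp_def, strictSum_nil_mul φ (List.cons_ne_nil _ _), mul_zero,
      sum_const_zero, add_zero, zero_add]
    simp only [strictSum_cons φ (z * w, l)]
    rw [list_sum_map_sum_mul (u := fun x => φ (z * w) ^ (x - p) / (x : R) ^ l)
      (f := fun X x => strictSum φ X x m), mul_sum]
    refine sum_congr rfl fun x _ => ?_
    rw [ih (by simp) (by simp) hk]
    ring
  | case5 z k c A w l ih =>
    rw [harmonicProduct, List.map_map, strictSum_mul_strictSum]
    simp only [Function.comp_def, mul_comm _ (strictSum φ [] _ _),
      strictSum_nil_mul φ (List.cons_ne_nil _ _), mul_zero, sum_const_zero, add_zero]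
    simp only [strictSum_cons φ (z * w, k)]
    rw [list_sum_map_sum_mul (u := fun x => φ (z * w) ^ (x - p) / (x : R) ^ k)
      (f := fun X x => strictSum φ X x m), mul_sum]
    refine sum_congr rfl fun x _ => ?_
    rw [ih (by simp) (by simp) (fun e he => hk e (by simp [he]))]
    ring
  | case6 z k c A w l d W ih1 ih2 ih3 =>
    rw [harmonicProduct, List.map_append, List.map_append, List.sum_append, List.sum_append,
      List.map_map, List.map_map, List.map_map, strictSum_mul_strictSum]
    have hk' : ∀ e ∈ c :: A, 1 ≤ e.2 := fun e he => hk e (List.mem_cons_of_mem _ he)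
    simp only [Function.comp_def]
    simp only [strictSum_cons φ (z * w, k), strictSum_cons φ (z * w, l),
      strictSum_cons φ (z * w, k + l)]
    rw [list_sum_map_sum_mul (u := fun x => φ (z * w) ^ (x - p) / (x : R) ^ k)
        (f := fun X x => strictSum φ X x m),
      list_sum_map_sum_mul (u := fun x => φ (z * w) ^ (x - p) / (x : R) ^ l)
        (f := fun X x => strictSum φ X x m),
      list_sum_map_sum_mul (u := fun x => φ (z * w) ^ (x - p) / (x : R) ^ (k + l))
        (f := fun X x => strictSum φ X x m), mul_add, mul_add, mul_sum, mul_sum, mul_sum]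
    refine congrArg₂ _ (congrArg₂ _ ?_ ?_) ?_
    · refine sum_congr rfl fun x _ => ?_
      rw [ih1 (by simp) (by simp) hk']
      ring
    · refine sum_congr rfl fun x _ => ?_
      rw [ih2 (by simp) (by simp) hk]
      ring
    · refine sum_congr rfl fun x _ => ?_
      rw [ih3 (by simp) (by simp) hk']
      ring

/-- The pairs which the boundary condition produces. -/
def boundaryList (B W : VarIndex) : List VarIndex := (strictify W).flatMap (harmonicProduct B)

theorem ne_nil_of_mem_strictify {W X : VarIndex} (h : X ∈ strictify W) : X ≠ [] := by
  induction W using strictify.induct with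
  | case1 => simp [strictify] at h
  | case2 c =>
    simp only [strictify, List.mem_singleton] at h
    simp [h]
  | case3 w l w' l' W ih1 ih2 =>
    rw [strictify, List.mem_append, List.mem_map] at h
    rcases h with ⟨Y, _, rfl⟩ | h
    · simp
    · exact ih2 h

theorem sum_boundaryList [CharZero R] {B W : VarIndex} (hB : B ≠ []) (hW : W ≠ [])
    (hk : ∀ c ∈ B, 1 ≤ c.2) (m : ℕ) :
    ((boundaryList B W).map fun X => strictSum φ X 0 m).sum =
      strictSum φ B 0 m * (m * weakSum φ W 0 m) := by
  rw [← sum_strictify φ W hW, boundaryList]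
  have : ∀ L : List VarIndex, (∀ X ∈ L, X ≠ []) →
      ((L.flatMap (harmonicProduct B)).map fun X => strictSum φ X 0 m).sum =
        strictSum φ B 0 m * (m * (L.map fun X => strictSum φ X 0 m).sum) := by
    intro L hL
    induction L with
    | nil => simp
    | cons X L ih =>
      rw [List.flatMap_cons, List.map_append, List.sum_append,
        ih fun Y hY => hL Y (List.mem_cons_of_mem _ hY),
        sum_harmonicProduct φ B X hB (hL X List.mem_cons_self) hk, List.map_cons, List.sum_cons]
      ring
  exact this _ fun X hX => ne_nil_of_mem_strictify hX

end Products

theorem valid_cons {c : ℂ × ℕ} {A : VarIndex} :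
    Valid (c :: A) ↔ (‖c.1‖ ≤ 1 ∧ 1 ≤ c.2) ∧ Valid A := List.forall_mem_cons

theorem valid_append {A B : VarIndex} : Valid (A ++ B) ↔ Valid A ∧ Valid B :=
  List.forall_mem_append

theorem valid_of_mem_strictify {W X : VarIndex} (hW : Valid W) (h : X ∈ strictify W) :
    Valid X := by
  induction W using strictify.induct generalizing X with
  | case1 => simp [strictify] at h
  | case2 c =>
    simp only [strictify, List.mem_singleton] at h
    exact h ▸ hW
  | case3 w l w' l' W ih1 ih2 =>
    rw [strictify, List.mem_append, List.mem_map] at h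
    rw [valid_cons, valid_cons] at hW
    rcases h with ⟨Y, hY, rfl⟩ | h
    · exact valid_cons.2 ⟨hW.1, ih1 (valid_cons.2 hW.2) hY⟩
    · exact ih2 (valid_cons.2 ⟨⟨hW.1.1, by have := hW.1.2; simp only at this ⊢; omega⟩,
        hW.2.2⟩) h

theorem norm_mul_le_one {z w : ℂ} (hz : ‖z‖ ≤ 1) (hw : ‖w‖ ≤ 1) : ‖z * w‖ ≤ 1 := by
  rw [norm_mul]; exact mul_le_one₀ hz (norm_nonneg _) hw

theorem valid_of_mem_harmonicProduct {B W X : VarIndex} (hB : Valid B) (hW : Valid W)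
    (h : X ∈ harmonicProduct B W) : X ≠ [] ∧ Valid X := by
  induction B, W using harmonicProduct.induct generalizing X with
  | case1 => simp [harmonicProduct] at h
  | case2 => simp [harmonicProduct] at h
  | case3 z k w l =>
    rw [harmonicProduct, List.mem_singleton] at h
    subst h
    rw [valid_cons] at hB hW
    refine ⟨by simp, valid_cons.2 ⟨⟨norm_mul_le_one hB.1.1 hW.1.1, ?_⟩, hB.2⟩⟩
    have h1 := hB.1.2; have h2 := hW.1.2
    simp only at h1 h2 ⊢; omega
  | case4 z k w l d W ih =>
    rw [harmonicProduct, List.mem_map] at h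
    obtain ⟨Y, hY, rfl⟩ := h
    have hB' := (valid_cons.1 hB).1
    rw [valid_cons] at hW
    exact ⟨by simp, valid_cons.2 ⟨⟨norm_mul_le_one hB'.1 hW.1.1, hW.1.2⟩, (ih hB hW.2 hY).2⟩⟩
  | case5 z k c A w l ih =>
    rw [harmonicProduct, List.mem_map] at h
    obtain ⟨Y, hY, rfl⟩ := h
    have hW' := (valid_cons.1 hW).1
    rw [valid_cons] at hB
    exact ⟨by simp, valid_cons.2 ⟨⟨norm_mul_le_one hB.1.1 hW'.1, hB.1.2⟩, (ih hB.2 hW hY).2⟩⟩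
  | case6 z k c A w l d W ih1 ih2 ih3 =>
    rw [harmonicProduct, List.mem_append, List.mem_append, List.mem_map, List.mem_map,
      List.mem_map] at h
    have hB' := valid_cons.1 hB
    have hW' := valid_cons.1 hW
    have hz := norm_mul_le_one hB'.1.1 hW'.1.1
    rcases h with (⟨Y, hY, rfl⟩ | ⟨Y, hY, rfl⟩) | ⟨Y, hY, rfl⟩
    · exact ⟨by simp, valid_cons.2 ⟨⟨hz, hB'.1.2⟩, (ih1 hB'.2 hW hY).2⟩⟩
    · exact ⟨by simp, valid_cons.2 ⟨⟨hz, hW'.1.2⟩, (ih2 hB hW'.2 hY).2⟩⟩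
    · exact ⟨by simp, valid_cons.2 ⟨⟨hz, hB'.1.2.trans (Nat.le_add_right _ _)⟩,
        (ih3 hB'.2 hW'.2 hY).2⟩⟩

/-! ### Combinations of convergent multiple polylogarithms -/

/-- The formal combinations of data of absolutely convergent multiple polylogarithms. -/
def convergent : Submodule ℤ (VarIndex →₀ ℤ) := Finsupp.supported ℤ ℤ {X | IsConvergentMPL X}

theorem mem_convergent {c : VarIndex →₀ ℤ} :
    c ∈ convergent ↔ ∀ X ∈ c.support, IsConvergentMPL X := Iff.rfl

theorem single_mem_convergent {X : VarIndex} (hX : IsConvergentMPL X) (a : ℤ) :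
    Finsupp.single X a ∈ convergent := Finsupp.single_mem_supported ℤ a hX

theorem evalLi_add (c d : VarIndex →₀ ℤ) : evalLi (c + d) = evalLi c + evalLi d :=
  Finsupp.sum_add_index' (by simp) (by intros; push_cast; ring)

/-- `evalLi` as an additive map. -/
def evalLiHom : (VarIndex →₀ ℤ) →+ ℂ := AddMonoidHom.mk' evalLi evalLi_add

theorem evalLi_neg (c : VarIndex →₀ ℤ) : evalLi (-c) = -evalLi c := map_neg evalLiHom c

theorem evalLi_sub (c d : VarIndex →₀ ℤ) : evalLi (c - d) = evalLi c - evalLi d :=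
  map_sub evalLiHom c d

theorem evalLi_zsmul (a : ℤ) (c : VarIndex →₀ ℤ) : evalLi (a • c) = a * evalLi c := by
  rw [← zsmul_eq_mul]; exact map_zsmul evalLiHom a c

theorem evalLi_sum {ι : Type*} (s : Finset ι) (c : ι → VarIndex →₀ ℤ) :
    evalLi (∑ i ∈ s, c i) = ∑ i ∈ s, evalLi (c i) := map_sum evalLiHom c s

theorem evalLi_zero : evalLi 0 = 0 := map_zero evalLiHom

theorem evalLi_single (X : VarIndex) (a : ℤ) : evalLi (Finsupp.single X a) = a * Li X := by
  rw [evalLi, Finsupp.sum_single_index (by simp)]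

theorem evalLi_list {L : List VarIndex} (hL : ∀ X ∈ L, Valid X ∧ X ≠ [])
    (h : ∀ X ∈ L, Summable (strictSum absHom X 0)) :
    (L.map fun X => Finsupp.single X (1 : ℤ)).sum ∈ convergent ∧
      HasSum (fun m => (L.map fun X => strictSum idHom X 0 m).sum)
        (evalLi (L.map fun X => Finsupp.single X (1 : ℤ)).sum) := by
  induction L with
  | nil => simp [evalLi_zero]
  | cons X L ih =>
    obtain ⟨h1, h2⟩ := ih (fun Y hY => hL Y (List.mem_cons_of_mem _ hY))
      fun Y hY => h Y (List.mem_cons_of_mem _ hY)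
    have hX := h X List.mem_cons_self
    have hX' := hL X List.mem_cons_self
    simp only [List.map_cons, List.sum_cons]
    refine ⟨add_mem (single_mem_convergent ⟨hX'.2, hX'.1, (summable_chainTerm_iff X).2 hX⟩ 1) h1,
      ?_⟩
    rw [evalLi_add, evalLi_single, Int.cast_one, one_mul]
    refine HasSum.add ?_ h2
    rw [Li_eq_tsum hX]
    exact (Summable.of_norm_bounded hX fun m => norm_strictSum_le X 0 m).hasSum

/-- The boundary condition. -/
theorem evalLi_boundary {B W : VarIndex} (hB : B ≠ []) (hW : W ≠ []) (hB' : Valid B)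
    (hW' : Valid W)
    (h : Summable fun m : ℕ => strictSum absHom B 0 m * (m * weakSum absHom W 0 m)) :
    boundary B W ∈ convergent ∧
      evalLi (boundary B W) =
        ∑' m : ℕ, strictSum idHom B 0 m * (m * weakSum idHom W 0 m) := by
  have hk : ∀ c ∈ B, 1 ≤ c.2 := fun c hc => (hB' c hc).2
  have hL : ∀ X ∈ boundaryList B W, Valid X ∧ X ≠ [] := by
    intro X hX
    obtain ⟨Y, hY, hX⟩ := List.mem_flatMap.1 hX
    exact (valid_of_mem_harmonicProduct hB' (valid_of_mem_strictify hW' hY) hX).symm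
  -- For absolute values all summands of the expansion are nonnegative, so each is dominated by the
  -- total. Convergence of `Z₁` thus passes to every polylogarithm produced.
  have := evalLi_list hL fun X hX => by
    refine Summable.of_nonneg_of_le (fun m => strictSum_nonneg X 0 m) (fun m => ?_) h
    rw [← sum_boundaryList absHom hB hW hk]
    refine List.single_le_sum ?_ _ (List.mem_map_of_mem (f := fun X => strictSum absHom X 0 m) hX)
    intro x hx
    obtain ⟨Y, _, rfl⟩ := List.mem_map.1 hx
    exact strictSum_nonneg Y 0 m
  refine ⟨this.1, ?_⟩
  simp only [sum_boundaryList idHom hB hW hk] at this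
  exact this.2.tsum_eq.symm

/-! ### Estimates -/

/-- Induction on m; the step is Bernoulli's inequality (1 - 1/(m+1))^ε ≤ 1 - ε/(m+1). -/
theorem sum_rpow_le {ε : ℝ} (h0 : 0 < ε) (h1 : ε ≤ 1) (m : ℕ) :
    ∑ x ∈ range m, ((x : ℝ) + 1) ^ (ε - 1) ≤ (m : ℝ) ^ ε / ε := by
  induction m with
  | zero => simp [Real.zero_rpow h0.ne']
  | succ m ih =>
    rw [sum_range_succ]
    refine (add_le_add_left ih _).trans ?_
    have hy : (0 : ℝ) < (m : ℝ) + 1 := by positivity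
    have hb : (1 + -(1 / ((m : ℝ) + 1))) ^ ε ≤ 1 + ε * -(1 / ((m : ℝ) + 1)) := by
      refine rpow_one_add_le_one_add_mul_self ?_ h0.le h1
      rw [neg_le_neg_iff, div_le_one hy]
      linarith [(Nat.cast_nonneg m : (0 : ℝ) ≤ m)]
    have h2 : (m : ℝ) ^ ε = ((m : ℝ) + 1) ^ ε * (1 + -(1 / ((m : ℝ) + 1))) ^ ε := by
      rw [← Real.mul_rpow hy.le]
      · congr 1; field_simp; ring
      · have : 1 / ((m : ℝ) + 1) ≤ 1 := by
          rw [div_le_one hy]; linarith [(Nat.cast_nonneg m : (0 : ℝ) ≤ m)]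
        linarith
    have h3 : ((m : ℝ) + 1) ^ (ε - 1) = ((m : ℝ) + 1) ^ ε / ((m : ℝ) + 1) := by
      rw [Real.rpow_sub hy, Real.rpow_one]
    have h4 := mul_le_mul_of_nonneg_left hb (Real.rpow_nonneg hy.le ε)
    rw [← h2] at h4
    push_cast
    rw [h3, le_div_iff₀ h0, add_mul, div_mul_cancel₀ _ h0.ne']
    have h5 : ((m : ℝ) + 1) ^ ε / ((m : ℝ) + 1) * ε =
      ((m : ℝ) + 1) ^ ε * (ε * (1 / ((m : ℝ) + 1))) := by ring
    rw [h5]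
    linarith

/-- One more column preserves the order of growth: summation raises the exponent ε - 1 to ε at the
cost of 1/ε, and division by m^k ≥ m ≥ (m+1)/2 lowers it again at the cost of 2. At m = 0 the
quotient is 0 by division by zero. -/
theorem step_le {ε : ℝ} (h0 : 0 < ε) (h1 : ε ≤ 1) {K : ℝ} (hK : 0 ≤ K) {f : ℕ → ℝ}
    (hf : ∀ x, f x ≤ K * ((x : ℝ) + 1) ^ (ε - 1)) (hf0 : ∀ x, 0 ≤ f x) {w : ℝ} (hw0 : 0 ≤ w)
    (hw : w ≤ 1) {k : ℕ} (hk : 1 ≤ k) {m : ℕ} {s : Finset ℕ} (hs : s ⊆ range (m + 1)) :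
    (∑ x ∈ s, f x * w ^ (m - x)) / (m : ℝ) ^ k ≤ 2 * K / ε * ((m : ℝ) + 1) ^ (ε - 1) := by
  rcases Nat.eq_zero_or_pos m with rfl | hm
  · rw [Nat.cast_zero, zero_pow (by omega), div_zero]
    positivity
  · have hm' : (1 : ℝ) ≤ m := by exact_mod_cast hm
    have h2 : ∑ x ∈ s, f x * w ^ (m - x) ≤ K * (((m : ℝ) + 1) ^ ε / ε) := by
      calc ∑ x ∈ s, f x * w ^ (m - x) ≤ ∑ x ∈ range (m + 1), f x * w ^ (m - x) :=
            sum_le_sum_of_subset_of_nonneg hs fun x _ _ => mul_nonneg (hf0 x) (by positivity)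
        _ ≤ ∑ x ∈ range (m + 1), K * ((x : ℝ) + 1) ^ (ε - 1) := by
            refine sum_le_sum fun x _ => ?_
            exact (mul_le_of_le_one_right (hf0 x) (pow_le_one₀ hw0 hw)).trans (hf x)
        _ ≤ _ := by
            rw [← mul_sum]
            have := sum_rpow_le h0 h1 (m + 1)
            push_cast at this
            exact mul_le_mul_of_nonneg_left this hK
    have h3 : (m : ℝ) + 1 ≤ 2 * (m : ℝ) ^ k := by
      have : (m : ℝ) ≤ (m : ℝ) ^ k := le_self_pow₀ hm' (by omega)
      linarith
    rw [Real.rpow_sub (by positivity), Real.rpow_one, div_le_iff₀ (by positivity)]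
    refine h2.trans ?_
    have h4 : 2 * K / ε * (((m : ℝ) + 1) ^ ε / ((m : ℝ) + 1)) * (m : ℝ) ^ k =
      K * (((m : ℝ) + 1) ^ ε / ε) * (2 * (m : ℝ) ^ k / ((m : ℝ) + 1)) := by
      field_simp
    rw [h4]
    refine le_mul_of_one_le_right (by positivity) ?_
    rw [le_div_iff₀ (by positivity)]
    linarith

/-- For chains that start at 0 the empty index is no exception: the only discrepancy would be at m =
0, where division by 0 ^ k = 0 makes the right-hand side vanish. -/
theorem weakSum_append_zero {R : Type*} [Field R] (φ : ℂ →*₀ R) (W : VarIndex) {c : ℂ × ℕ}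
    (hc : 1 ≤ c.2) (m : ℕ) :
    weakSum φ (W ++ [c]) 0 m =
      (∑ x ∈ range (m + 1), weakSum φ W 0 x * φ c.1 ^ (m - x)) / (m : R) ^ c.2 := by
  by_cases hW : W = []
  · subst hW
    rcases Nat.eq_zero_or_pos m with rfl | hm
    · simp [weakSum, show c.2 ≠ 0 by omega]
    · simp [weakSum, weakTail, hm]
  · rw [weakSum_append φ hW, Nat.range_succ_eq_Icc_zero]

theorem rpow_nat_add_one_pos (x : ℕ) (s : ℝ) : 0 < ((x : ℝ) + 1) ^ s :=
  Real.rpow_pos_of_pos (by positivity) s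

theorem delta_le (s : ℝ) (x : ℕ) : (if 0 = x then (1 : ℝ) else 0) ≤ 1 * ((x : ℝ) + 1) ^ s := by
  split_ifs with h
  · subst h; simp
  · rw [one_mul]; exact (rpow_nat_add_one_pos x s).le

theorem exists_strictSum_le {ε : ℝ} (h0 : 0 < ε) (h1 : ε ≤ 1) {A : VarIndex} (hA : Valid A) :
    ∃ K : ℝ, 0 ≤ K ∧ ∀ m : ℕ, strictSum absHom A 0 m ≤ K * ((m : ℝ) + 1) ^ (ε - 1) := by
  induction A using List.reverseRecOn with
  | nil => exact ⟨1, zero_le_one, delta_le _⟩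
  | append_singleton A c ih =>
    rw [valid_append] at hA
    obtain ⟨K, hK, h⟩ := ih hA.1
    have hc := hA.2 c (by simp)
    refine ⟨2 * K / ε, by positivity, fun m => ?_⟩
    rw [strictSum_append]
    exact step_le h0 h1 hK h (strictSum_nonneg A 0) (norm_nonneg _) hc.1 hc.2
      fun x hx => by rw [mem_Ico] at hx; rw [mem_range]; omega

theorem exists_weakSum_le {ε : ℝ} (h0 : 0 < ε) (h1 : ε ≤ 1) {A : VarIndex} (hA : Valid A) :
    ∃ K : ℝ, 0 ≤ K ∧ ∀ m : ℕ, weakSum absHom A 0 m ≤ K * ((m : ℝ) + 1) ^ (ε - 1) := by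
  induction A using List.reverseRecOn with
  | nil => exact ⟨1, zero_le_one, delta_le _⟩
  | append_singleton A c ih =>
    rw [valid_append] at hA
    obtain ⟨K, hK, h⟩ := ih hA.1
    have hc := hA.2 c (by simp)
    refine ⟨2 * K / ε, by positivity, fun m => ?_⟩
    rw [weakSum_append_zero absHom A hc.2]
    exact step_le h0 h1 hK h (weakSum_nonneg A 0) (norm_nonneg _) hc.1 hc.2 subset_rfl

theorem summable_rpow {s : ℝ} (hs : s < -1) : Summable fun x : ℕ => ((x : ℝ) + 1) ^ s := by
  have := (summable_nat_add_iff 1).2 (Real.summable_nat_rpow.2 hs)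
  simpa using this

/-! ### Convergence of `Z₁` -/

/-- The general bound for the terms of `Z₁`. -/
theorem summable_one_of_bound {f g : ℕ → ℝ} {K L : ℝ} (hK : 0 ≤ K)
    (hf0 : ∀ m, 0 ≤ f m) (hg0 : ∀ m, 0 ≤ g m)
    (hf : ∀ m : ℕ, f m ≤ K * ((m : ℝ) + 1) ^ ((1 / 4 : ℝ) - 1))
    (hg : ∀ m : ℕ, g m ≤ L * ((m : ℝ) + 1) ^ ((1 / 4 : ℝ) - 1)) :
    Summable fun m => f m * g m := by
  -- The exponent is -3/2; any ε below 1/2 in place of 1/4 would do.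
  have h := (summable_rpow (s := (1 / 4 - 1) + (1 / 4 - 1)) (by norm_num)).mul_left (K * L)
  refine Summable.of_nonneg_of_le (fun m => mul_nonneg (hf0 m) (hg0 m)) (fun m => ?_) h
  refine (mul_le_mul (hf m) (hg m) (hg0 m)
    (mul_nonneg hK (rpow_nat_add_one_pos m _).le)).trans (le_of_eq ?_)
  rw [Real.rpow_add (by positivity)]
  ring

/-- The bound for g decreases, so it may be evaluated at x ≤ m instead of m. What remains is a
Cauchy product of a summable sequence with a geometric series. -/
theorem summable_convolution_of_bound {f g : ℕ → ℝ} {K L w : ℝ} (hK : 0 ≤ K) (hL : 0 ≤ L)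
    (hf0 : ∀ m, 0 ≤ f m) (hg0 : ∀ m, 0 ≤ g m) (hw0 : 0 ≤ w) (hw : w < 1)
    (hf : ∀ m : ℕ, f m ≤ K * ((m : ℝ) + 1) ^ ((1 / 4 : ℝ) - 1))
    (hg : ∀ m : ℕ, g m ≤ L * ((m : ℝ) + 1) ^ ((1 / 4 : ℝ) - 1)) :
    Summable fun m => (∑ x ∈ range (m + 1), f x * w ^ (m - x)) * g m := by
  have hu : Summable fun m : ℕ => f m * (L * ((m : ℝ) + 1) ^ ((1 / 4 : ℝ) - 1)) :=
    summable_one_of_bound hK hf0 (fun m => mul_nonneg hL (rpow_nat_add_one_pos m _).le) hf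
      fun _ => le_rfl
  have h := (summable_norm_sum_mul_range_of_summable_norm hu.norm
    (summable_geometric_of_lt_one hw0 hw).norm).of_norm
  refine Summable.of_nonneg_of_le (fun m => ?_) (fun m => ?_) h
  · exact mul_nonneg (sum_nonneg fun x _ => mul_nonneg (hf0 x) (by positivity)) (hg0 m)
  · rw [sum_mul]
    refine sum_le_sum fun x hx => ?_
    rw [mul_right_comm]
    refine mul_le_mul_of_nonneg_right (mul_le_mul_of_nonneg_left ?_ (hf0 x)) (by positivity)
    refine (hg m).trans (mul_le_mul_of_nonneg_left ?_ hL)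
    refine Real.rpow_le_rpow_of_nonpos (by positivity) ?_ (by norm_num)
    have : (x : ℝ) ≤ m := by exact_mod_cast Nat.lt_succ_iff.1 (mem_range.1 hx)
    linarith

/-- The factor m costs one power of the last entry. If k ≥ 2 or l ≥ 2, the remaining exponents are
still positive and both factors keep their bound. If k = l = 1, one last column is used up, and its
geometric factor |z| < 1 or |w| < 1 gives convergence. -/
theorem summable_one {B W : VarIndex} {z w : ℂ} {k l : ℕ} (hB : Valid (B ++ [(z, k)]))
    (hW : Valid (W ++ [(w, l)])) (h : k = 1 → l = 1 → ‖z‖ < 1 ∨ ‖w‖ < 1) :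
    Summable fun m : ℕ => strictSum absHom (B ++ [(z, k)]) 0 m *
      (m * weakSum absHom (W ++ [(w, l)]) 0 m) := by
  have e0 : (0 : ℝ) < 1 / 4 := by norm_num
  have e1 : (1 / 4 : ℝ) ≤ 1 := by norm_num
  obtain ⟨hB1, hB2⟩ := valid_append.1 hB
  obtain ⟨hW1, hW2⟩ := valid_append.1 hW
  have hz := hB2 (z, k) (by simp)
  have hw := hW2 (w, l) (by simp)
  simp only at hz hw
  -- Equality holds except possibly at m = 0, where the left-hand side is 0.
  have key : ∀ {f g : ℕ → ℝ} {m : ℕ}, (∀ m, 0 ≤ f m) → (∀ m, 0 ≤ g m) →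
      f m / m * (m * g m) ≤ f m * g m := by
    intro f g m hf hg
    rcases Nat.eq_zero_or_pos m with rfl | hm
    · simpa using mul_nonneg (hf 0) (hg 0)
    · have : (m : ℝ) ≠ 0 := by rw [Nat.cast_ne_zero]; omega
      refine le_of_eq ?_
      field_simp
  have hm0 : ∀ m : ℕ, 0 ≤ strictSum absHom (B ++ [(z, k)]) 0 m *
      (m * weakSum absHom (W ++ [(w, l)]) 0 m) := fun m =>
    mul_nonneg (strictSum_nonneg _ _ _) (mul_nonneg (Nat.cast_nonneg m) (weakSum_nonneg _ _ _))
  obtain ⟨K, hK, hKb⟩ := exists_strictSum_le e0 e1 hB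
  obtain ⟨L, hL, hLb⟩ := exists_weakSum_le e0 e1 hW
  by_cases hk : k = 1
  · by_cases hl : l = 1
    · subst hk hl
      rcases h rfl rfl with h | h
      · obtain ⟨K', hK', hKb'⟩ := exists_strictSum_le e0 e1 hB1
        refine Summable.of_nonneg_of_le hm0 (fun m => ?_)
          (summable_convolution_of_bound hK' hL (strictSum_nonneg B 0) (weakSum_nonneg _ 0)
            (norm_nonneg z) h hKb' hLb)
        rw [strictSum_append, pow_one]
        refine (key (f := fun m => ∑ x ∈ Ico 0 m, strictSum absHom B 0 x * absHom z ^ (m - x))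
          (fun m => sum_nonneg fun x _ => mul_nonneg (strictSum_nonneg _ _ _)
            (pow_nonneg (norm_nonneg z) _)) (weakSum_nonneg (W ++ [(w, 1)]) 0)).trans ?_
        refine mul_le_mul_of_nonneg_right ?_ (weakSum_nonneg _ _ _)
        refine sum_le_sum_of_subset_of_nonneg (fun x hx => ?_) fun x _ _ =>
          mul_nonneg (strictSum_nonneg _ _ _) (pow_nonneg (norm_nonneg z) _)
        rw [mem_Ico] at hx; rw [mem_range]; omega
      · obtain ⟨K', hK', hKb'⟩ := exists_weakSum_le e0 e1 hW1
        refine Summable.of_nonneg_of_le hm0 (fun m => ?_)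
          (summable_convolution_of_bound hK' hK (weakSum_nonneg W 0) (strictSum_nonneg _ 0)
            (norm_nonneg w) h hKb' hKb)
        rw [weakSum_append_zero absHom W (c := (w, 1)) le_rfl, pow_one]
        have := key (f := fun m => ∑ x ∈ range (m + 1), weakSum absHom W 0 x * absHom w ^ (m - x))
          (m := m) (fun m => sum_nonneg fun x _ => mul_nonneg (weakSum_nonneg _ _ _)
            (pow_nonneg (norm_nonneg w) _)) (strictSum_nonneg (B ++ [(z, 1)]) 0)
        refine le_trans (le_of_eq ?_) this
        ring
    · obtain ⟨l, rfl⟩ : ∃ l', l = l' + 1 := ⟨l - 1, by omega⟩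
      have hW' : Valid (W ++ [(w, l)]) := valid_append.2 ⟨hW1, by
        intro c hc
        rw [List.mem_singleton] at hc
        subst hc
        exact ⟨hw.1, by simp only; omega⟩⟩
      obtain ⟨L', hL', hLb'⟩ := exists_weakSum_le e0 e1 hW'
      refine Summable.of_nonneg_of_le hm0 (fun m => ?_)
          (summable_one_of_bound hK (strictSum_nonneg _ 0) (weakSum_nonneg _ 0) hKb hLb')
      rw [← up_append, weakSum_up absHom (by simp), mul_comm (strictSum _ _ _ _),
        mul_comm (strictSum _ _ _ _), mul_comm (m : ℝ), mul_assoc]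
      exact key (weakSum_nonneg _ 0) (strictSum_nonneg _ 0)
  · obtain ⟨k, rfl⟩ : ∃ k', k = k' + 1 := ⟨k - 1, by omega⟩
    have hB' : Valid (B ++ [(z, k)]) := valid_append.2 ⟨hB1, by
      intro c hc
      rw [List.mem_singleton] at hc
      subst hc
      exact ⟨hz.1, by simp only; omega⟩⟩
    obtain ⟨K', hK', hKb'⟩ := exists_strictSum_le e0 e1 hB'
    refine Summable.of_nonneg_of_le hm0 (fun m => ?_)
        (summable_one_of_bound hK' (strictSum_nonneg _ 0) (weakSum_nonneg _ 0) hKb' hLb)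
    rw [← up_append, strictSum_up absHom (by simp)]
    exact key (strictSum_nonneg _ 0) (weakSum_nonneg _ 0)

theorem slice_one {R : Type*} [Field R] [CharZero R] (φ : ℂ →*₀ R) (A : Fin 1 → VarIndex)
    (W : VarIndex) (a : Fin 1 → ℕ) :
    slice φ A W a = strictSum φ (A 0) 0 (a 0) * (a 0 * weakSum φ W 0 (a 0)) := by
  have : ((a 0).factorial : R) ≠ 0 := by exact_mod_cast (a 0).factorial_ne_zero
  simp [slice, conn, this]

theorem summable_slice_one {A : Fin 1 → VarIndex} {W : VarIndex} :
    Summable (slice absHom A W) ↔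
      Summable fun m : ℕ => strictSum absHom (A 0) 0 m * (m * weakSum absHom W 0 m) := by
  rw [← (Equiv.funUnique (Fin 1) ℕ).summable_iff]
  refine Eq.to_iff (congrArg Summable (funext fun a => ?_))
  exact slice_one absHom A W a

theorem tsum_slice_one (A : Fin 1 → VarIndex) (W : VarIndex) :
    ∑' a, slice idHom A W a =
      ∑' m : ℕ, strictSum idHom (A 0) 0 m * (m * weakSum idHom W 0 m) := by
  rw [← (Equiv.funUnique (Fin 1) ℕ).tsum_eq]
  exact tsum_congr fun a => slice_one idHom A W a

/-! ### Convergence of connected sums with at least two non-empty components -/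

theorem summable_prod_apply {f : ℕ → ℝ} (hf0 : ∀ x, 0 ≤ f x) (hf : Summable f) (n : ℕ) :
    Summable fun a : Fin n → ℕ => ∏ i, f (a i) := by
  induction n with
  | zero => exact (hasSum_fintype _).summable
  | succ n ih =>
    rw [← (Fin.insertNthEquiv (fun _ : Fin (n + 1) => ℕ) 0).summable_iff]
    refine (hf.mul_of_nonneg ih hf0 fun a => prod_nonneg fun i _ => hf0 _).congr fun p => ?_
    simp [Fin.prod_univ_succ, Fin.insertNthEquiv]

/-- Equivalently, the binomial coefficient of s + r over s is at least s + r. After one factor s + r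
is cancelled, induction on r applies. -/
theorem factorial_mul_factorial_mul_le {s r : ℕ} (hs : 1 ≤ s) (hr : 1 ≤ r) :
    s.factorial * r.factorial * (s + r) ≤ (s + r).factorial := by
  obtain ⟨r, rfl⟩ : ∃ r', r = r' + 1 := ⟨r - 1, by omega⟩
  rw [← add_assoc, Nat.factorial_succ (s + r), mul_comm (s + r + 1)]
  refine Nat.mul_le_mul_right _ ?_
  clear hr
  induction r with
  | zero => simp
  | succ r ih =>
    calc s.factorial * (r + 1 + 1).factorial
        = (r + 1 + 1) * (s.factorial * (r + 1).factorial) := by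
          rw [Nat.factorial_succ (r + 1)]; ring
      _ ≤ (s + r + 1) * (s + r).factorial := Nat.mul_le_mul (by omega) ih
      _ = (s + (r + 1)).factorial := by rw [← add_assoc, Nat.factorial_succ]

/-- Treat all entries other than `a i` as one block: the product of their factorials divides the
factorial of their sum, which is at least `a k`. This reduces the claim to two entries. -/
theorem conn_mul_le {n : ℕ} {a : Fin n → ℕ} {i k : Fin n} (hik : i ≠ k) (hi : 1 ≤ a i)
    (hk : 1 ≤ a k) : conn ℝ a * ((∑ j, a j : ℕ) : ℝ) ≤ 1 := by
  have h : (∏ j, (a j).factorial) * ∑ j, a j ≤ (∑ j, a j).factorial := by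
    rw [← mul_prod_erase univ _ (mem_univ i), ← add_sum_erase univ _ (mem_univ i)]
    have hr : 1 ≤ ∑ j ∈ univ.erase i, a j :=
      hk.trans (single_le_sum (f := a) (fun _ _ => Nat.zero_le _) (by simp [hik.symm]))
    refine le_trans ?_ (factorial_mul_factorial_mul_le hi hr)
    refine Nat.mul_le_mul_right _ (Nat.mul_le_mul_left _ ?_)
    exact Nat.le_of_dvd (Nat.factorial_pos _) (Nat.prod_factorial_dvd_factorial_sum _ _)
  rw [conn, div_mul_eq_mul_div, div_le_one (by positivity)]
  exact_mod_cast h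

theorem summable_slice_of_ne_nil {n : ℕ} {A : Fin n → VarIndex} {W : VarIndex}
    (hA : ∀ i, Valid (A i)) (hW : Valid W) (hne : ∀ i, A i ≠ []) {i k : Fin n} (hik : i ≠ k) :
    Summable (slice absHom A W) := by
  have hn : (0 : ℝ) < n := by exact_mod_cast (Fin.pos i)
  -- Each variable a_j receives the exponent (ε - 1)(1 + 1/n): one part from its own chain sum, and
  -- an n-th share of the decay in N. It is below -1 exactly when ε < 1/(n + 1).
  set ε : ℝ := 1 / (2 * (n + 1)) with hε
  have h0 : 0 < ε := by positivity
  have h1 : ε ≤ 1 := by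
    rw [hε, div_le_one (by positivity)]; linarith
  choose K hK hKb using fun i => exists_strictSum_le h0 h1 (hA i)
  obtain ⟨L, hL, hLb⟩ := exists_weakSum_le h0 h1 hW
  have hs : (ε - 1) + (ε - 1) / n < -1 := by
    rw [hε]
    have : (1 / (2 * ((n : ℝ) + 1)) - 1) + (1 / (2 * ((n : ℝ) + 1)) - 1) / n + 1 =
      -(1 / (2 * n)) := by
      field_simp; ring
    have h2 : 0 < 1 / (2 * (n : ℝ)) := by positivity
    linarith
  have hsum := (summable_prod_apply (fun x => (rpow_nat_add_one_pos x _).le)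
    (summable_rpow hs) n).mul_left ((∏ i, K i) * L)
  refine Summable.of_nonneg_of_le (slice_nonneg A W) (fun a => ?_) hsum
  -- A nonempty strict chain cannot end at 0, so such slices vanish. Otherwise all entries are
  -- positive and `conn_mul_le` applies.
  by_cases ha : ∃ j, a j = 0
  · obtain ⟨j, hj⟩ := ha
    rw [slice, prod_eq_zero (mem_univ j) (by rw [hj, strictSum_self absHom (hne j)])]
    rw [mul_zero, zero_mul]
    exact mul_nonneg (mul_nonneg (prod_nonneg fun i _ => hK i) hL)
      (prod_nonneg fun x _ => (rpow_nat_add_one_pos _ _).le)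
  · have ha' : ∀ j, 1 ≤ a j := fun j => Nat.one_le_iff_ne_zero.2 fun h => ha ⟨j, h⟩
    set N := ∑ j, a j with hN
    have hb : ((N : ℝ) + 1) ^ (ε - 1) ≤ ∏ j, ((a j : ℝ) + 1) ^ ((ε - 1) / n) := by
      calc ((N : ℝ) + 1) ^ (ε - 1) = ∏ _j : Fin n, ((N : ℝ) + 1) ^ ((ε - 1) / n) := by
            rw [prod_const, card_univ, Fintype.card_fin, ← Real.rpow_natCast,
              ← Real.rpow_mul (by positivity), div_mul_cancel₀ _ hn.ne']
        _ ≤ _ := by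
            refine prod_le_prod (fun j _ => by positivity) fun j _ => ?_
            refine Real.rpow_le_rpow_of_nonpos (by positivity) ?_ ?_
            · have : a j ≤ N := single_le_sum (f := a) (fun _ _ => Nat.zero_le _) (mem_univ j)
              have : (a j : ℝ) ≤ N := by exact_mod_cast this
              linarith
            · exact div_nonpos_of_nonpos_of_nonneg (by linarith) hn.le
    have hprod : ∏ j, strictSum absHom (A j) 0 (a j) ≤
        ∏ j, K j * ((a j : ℝ) + 1) ^ (ε - 1) :=
      prod_le_prod (fun j _ => strictSum_nonneg _ _ _) fun j _ => hKb j (a j)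
    have hprod0 : 0 ≤ ∏ j, strictSum absHom (A j) 0 (a j) :=
      prod_nonneg fun j _ => strictSum_nonneg _ _ _
    calc slice absHom A W a
        = (conn ℝ a * (N : ℝ)) *
          ((∏ j, strictSum absHom (A j) 0 (a j)) * weakSum absHom W 0 N) := by
          rw [slice]; ring
      _ ≤ (∏ j, strictSum absHom (A j) 0 (a j)) * weakSum absHom W 0 N :=
          mul_le_of_le_one_left (mul_nonneg hprod0 (weakSum_nonneg _ _ _))
            (conn_mul_le hik (ha' i) (ha' k))
      _ ≤ (∏ j, K j * ((a j : ℝ) + 1) ^ (ε - 1)) *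
          (L * ∏ j, ((a j : ℝ) + 1) ^ ((ε - 1) / n)) :=
          mul_le_mul hprod ((hLb N).trans (mul_le_mul_of_nonneg_left hb hL))
            (weakSum_nonneg _ _ _) (hprod0.trans hprod)
      _ = _ := by
          rw [prod_mul_distrib]
          have : ∏ j, ((a j : ℝ) + 1) ^ (ε - 1 + (ε - 1) / n) =
            (∏ j, ((a j : ℝ) + 1) ^ (ε - 1)) * ∏ j, ((a j : ℝ) + 1) ^ ((ε - 1) / n) := by
            rw [← prod_mul_distrib]
            exact prod_congr rfl fun j _ => Real.rpow_add (by positivity) _ _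
          rw [this]
          ring

/-! ### Omitting empty components -/

section Drop

variable {R : Type*} [Field R] (φ : ℂ →*₀ R)

theorem slice_insertNth {n : ℕ} {A : Fin (n + 1) → VarIndex} (W : VarIndex) {i : Fin (n + 1)}
    (hi : A i = []) (a : Fin n → ℕ) :
    slice φ A W (i.insertNth 0 a : Fin (n + 1) → ℕ) =
      slice φ (fun l => A (i.succAbove l)) W a := by
  simp [slice, conn, Fin.prod_univ_succAbove _ i, Fin.sum_univ_succAbove _ i, hi, strictSum]

theorem slice_eq_zero_of_nil {n : ℕ} {A : Fin (n + 1) → VarIndex} (W : VarIndex)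
    {i : Fin (n + 1)} (hi : A i = []) {a : Fin (n + 1) → ℕ} (ha : a i ≠ 0) :
    slice φ A W a = 0 := by
  rw [slice, prod_eq_zero (mem_univ i) (by simp [hi, strictSum, ha.symm])]
  simp

theorem insertNth_zero_injective {n : ℕ} (i : Fin (n + 1)) :
    Function.Injective fun a : Fin n → ℕ => (i.insertNth 0 a : Fin (n + 1) → ℕ) :=
  Fin.insertNth_right_injective (α := fun _ => ℕ) 0

/-- The chain of an empty component ends at 0, so the slices are supported on tuples with a 0
inserted at that position; there it contributes 0! = 1 and nothing to N. -/
theorem slice_eq_zero_of_notMem_range {n : ℕ} {A : Fin (n + 1) → VarIndex} (W : VarIndex)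
    {i : Fin (n + 1)} (hi : A i = []) (a : Fin (n + 1) → ℕ)
    (ha : a ∉ Set.range fun a : Fin n → ℕ => (i.insertNth 0 a : Fin (n + 1) → ℕ)) :
    slice φ A W a = 0 := by
  refine slice_eq_zero_of_nil φ W hi fun h => ha ⟨fun l => a (i.succAbove l), ?_⟩
  rw [Fin.insertNth_eq_iff]
  exact ⟨h.symm, rfl⟩

end Drop

theorem summable_slice_drop {n : ℕ} {A : Fin (n + 1) → VarIndex} {W : VarIndex} {i : Fin (n + 1)}
    (hi : A i = []) :
    Summable (slice absHom A W) ↔ Summable (slice absHom (fun l => A (i.succAbove l)) W) := by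
  rw [← (insertNth_zero_injective i).summable_iff (slice_eq_zero_of_notMem_range absHom W hi)]
  exact Eq.to_iff (congrArg Summable (funext fun a => slice_insertNth absHom W hi a))

theorem tsum_slice_drop {n : ℕ} {A : Fin (n + 1) → VarIndex} (W : VarIndex) {i : Fin (n + 1)}
    (hi : A i = []) :
    ∑' a, slice idHom A W a = ∑' a, slice idHom (fun l => A (i.succAbove l)) W a := by
  rw [← (insertNth_zero_injective i).tsum_eq]
  · exact tsum_congr fun a => slice_insertNth idHom W hi a
  · intro a ha
    by_contra h
    exact ha (slice_eq_zero_of_notMem_range idHom W hi a h)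

theorem summable_slice_of_two {n : ℕ} {A : Fin n → VarIndex} {W : VarIndex}
    (hA : ∀ i, Valid (A i)) (hW : Valid W) {i k : Fin n} (hik : i ≠ k) (hi : A i ≠ [])
    (hk : A k ≠ []) : Summable (slice absHom A W) := by
  induction n with
  | zero => exact i.elim0
  | succ n ih =>
    by_cases h : ∃ j, A j = []
    · obtain ⟨j, hj⟩ := h
      rw [summable_slice_drop hj]
      obtain ⟨i', rfl⟩ := Fin.exists_succAbove_eq (x := i) (y := j) fun h => hi (h ▸ hj)
      obtain ⟨k', rfl⟩ := Fin.exists_succAbove_eq (x := k) (y := j) fun h => hk (h ▸ hj)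
      exact ih (fun l => hA _) (fun h => hik (congrArg _ h)) hi hk
    · exact summable_slice_of_ne_nil hA hW (fun j hj => h ⟨j, hj⟩) hik

end Sums

/-! ### The transport relation, by telescoping over the total size N. -/

section Transport

open Finset Filter Topology

/-! ### The transport relation -/

/-- A nonzero limit would make u n / n comparable to the harmonic series. -/
theorem eq_zero_of_tendsto_of_summable_div {u : ℕ → ℂ} {L : ℂ} (hu : Tendsto u atTop (𝓝 L))
    (hs : Summable fun n : ℕ => u n / n) : L = 0 := by
  by_contra hL
  have hL' : 0 < ‖L‖ := norm_pos_iff.2 hL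
  have h1 : ∀ᶠ n in atTop, ‖L‖ / 2 < ‖u n‖ := hu.norm.eventually_const_lt (by linarith)
  refine Real.not_summable_one_div_natCast
    (Summable.of_norm_bounded_eventually_nat (hs.norm.mul_left (2 / ‖L‖)) ?_)
  filter_upwards [h1] with n hn
  rw [norm_div (u n), Complex.norm_natCast, Real.norm_of_nonneg (by positivity), ← mul_div_assoc]
  refine div_le_div_of_nonneg_right ?_ (Nat.cast_nonneg n)
  rw [div_mul_eq_mul_div, le_div_iff₀ hL']
  linarith

theorem hasSum_sum_fibre {α β : Type*} {F : α → Finset β} (π : β → α)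
    (hF : ∀ a b, b ∈ F a ↔ π b = a) {h : β → ℂ} (hh : Summable h) :
    HasSum (fun a => ∑ b ∈ F a, h b) (∑' b, h b) := by
  have h1 := hh.hasSum.tsum_fiberwise π
  refine h1.congr_fun fun a => ?_
  have h2 : π ⁻¹' {a} = (F a : Set β) := by
    ext b
    simp [hF]
  rw [h2, Finset.tsum_subtype']

theorem prod_apply_update {M : Type*} [CommMonoid M] {n : ℕ} (h : Fin n → ℕ → M) (b : Fin n → ℕ)
    (i : Fin n) (x : ℕ) :
    ∏ j, h j (Function.update b i x j) = h i x * ∏ j ∈ univ.erase i, h j (b j) := by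
  rw [← mul_prod_erase univ _ (mem_univ i), Function.update_self]
  congr 1
  refine prod_congr rfl fun j hj => ?_
  rw [Function.update_of_ne (ne_of_mem_erase hj)]

theorem sum_update {n : ℕ} (b : Fin n → ℕ) (i : Fin n) (x : ℕ) :
    ∑ j, Function.update b i x j = x + ∑ j ∈ univ.erase i, b j := by
  rw [← add_sum_erase univ _ (mem_univ i), Function.update_self]
  congr 1
  refine sum_congr rfl fun j hj => ?_
  rw [Function.update_of_ne (ne_of_mem_erase hj)]

theorem sum_update_succ {n : ℕ} (b : Fin n → ℕ) (i : Fin n) :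
    ∑ j, Function.update b i (b i + 1) j = ∑ j, b j + 1 := by
  rw [sum_update, ← add_sum_erase univ b (mem_univ i)]
  ring

/-- This identity is the only algebraic property of the connector that the transport relation needs.
-/
theorem conn_update_succ {n : ℕ} (b : Fin n → ℕ) (i : Fin n) :
    conn ℂ (Function.update b i (b i + 1)) * (((∑ j, b j : ℕ) : ℂ) + 1) =
      conn ℂ b * (b i + 1) := by
  have h3 : ((∑ j, b j).factorial : ℂ) ≠ 0 := by exact_mod_cast Nat.factorial_ne_zero _
  have h4 : (((∑ j, b j : ℕ) : ℂ) + 1) ≠ 0 := Nat.cast_add_one_ne_zero _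
  rw [conn, conn, sum_update_succ, prod_apply_update (fun _ x => (x.factorial : ℂ)),
    ← mul_prod_erase univ (fun j => ((b j).factorial : ℂ)) (mem_univ i), Nat.factorial_succ,
    Nat.factorial_succ]
  rw [Nat.cast_mul, Nat.cast_mul, Nat.cast_add_one, Nat.cast_add_one]
  field_simp

section Telescope

variable {n : ℕ} {f F : Fin n → ℕ → ℂ} {r : Fin n → ℂ} {g G : ℕ → ℂ} {t : ℂ}

/-- The sum over the tuples of given size, with an arrow on each component. -/
def fullSum (F : Fin n → ℕ → ℂ) (N : ℕ) : ℂ :=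
  ∑ a ∈ Nat.antidiagonalTuple n N, conn ℂ a * ∏ j, F j (a j)

/-- The sum over the tuples of given size, with an arrow on each component but the `i`-th. -/
def partSum (f F : Fin n → ℕ → ℂ) (i : Fin n) (N : ℕ) : ℂ :=
  ∑ a ∈ Nat.antidiagonalTuple n N, conn ℂ a * (f i (a i) * ∏ j ∈ univ.erase i, F j (a j))

/-- For fixed i, lower the i-th entry by one and use the recursions of the connector and of F i.
Adding over i, the factors r i give t, and the factors a i give N. -/
theorem fullSum_succ (ht : ∑ i, r i = t) (hF0 : ∀ i, F i 0 = 0)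
    (hrec : ∀ i (a : ℕ), r i * (((a : ℂ) + 1) * F i (a + 1)) = a * F i a + f i a) (N : ℕ) :
    t * (((N : ℂ) + 1) * fullSum F (N + 1)) = ∑ i, partSum f F i N + N * fullSum F N := by
  have h1 : ∀ i, r i * (((N : ℂ) + 1) * fullSum F (N + 1)) =
      partSum f F i N + ∑ a ∈ Nat.antidiagonalTuple n N, a i * (conn ℂ a * ∏ j, F j (a j)) := by
    intro i
    rw [fullSum, partSum, mul_sum, mul_sum, ← sum_add_distrib]
    symm
    -- Raising the i-th entry reaches exactly the tuples of size N + 1 with positive i-th entry; the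
    -- others vanish since F i 0 = 0.
    refine sum_of_injOn (fun b => Function.update b i (b i + 1)) ?_ ?_ ?_ ?_
    · intro a _ b _ h
      funext j
      have hj := congrFun h j
      rcases eq_or_ne j i with rfl | hji
      · simpa using hj
      · simpa [hji] using hj
    · intro b hb
      rw [mem_coe, Nat.mem_antidiagonalTuple] at hb ⊢
      rw [sum_update_succ, hb]
    · intro a ha ha'
      rw [Nat.mem_antidiagonalTuple] at ha
      have : a i = 0 := by
        by_contra h
        have h2 : Function.update (Function.update a i (a i - 1)) i
            (Function.update a i (a i - 1) i + 1) = a := by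
          rw [Function.update_self, Function.update_idem, Nat.sub_add_cancel (by omega),
            Function.update_eq_self]
        refine ha' ⟨Function.update a i (a i - 1), ?_, h2⟩
        rw [mem_coe, Nat.mem_antidiagonalTuple]
        have h3 := sum_update_succ (Function.update a i (a i - 1)) i
        rw [h2, ha] at h3
        omega
      rw [prod_eq_zero (mem_univ i) (by rw [this, hF0])]
      simp
    · intro b hb
      rw [Nat.mem_antidiagonalTuple] at hb
      have h2 := conn_update_succ b i
      rw [hb] at h2
      have h3 : ∏ j, F j (Function.update b i (b i + 1) j) =
          F i (b i + 1) * ∏ j ∈ univ.erase i, F j (b j) := prod_apply_update F b i _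
      rw [h3, ← mul_prod_erase univ (fun j => F j (b j)) (mem_univ i)]
      linear_combination (-(r i * F i (b i + 1) * ∏ j ∈ univ.erase i, F j (b j))) * h2 -
        conn ℂ b * (∏ j ∈ univ.erase i, F j (b j)) * hrec i (b i)
  rw [← ht, sum_mul, sum_congr rfl fun i _ => h1 i, sum_add_distrib]
  congr 1
  rw [sum_comm, fullSum, mul_sum]
  refine sum_congr rfl fun a ha => ?_
  rw [Nat.mem_antidiagonalTuple] at ha
  rw [← sum_mul, ← ha, Nat.cast_sum]

/-- With G'(M) = ∑ g(x) t^(M-x) one has G'(M+1) = t G'(M) + g(M+1). The right-hand side at M plus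
the next summand is, by `fullSum_succ`, the right-hand side at M + 1. -/
theorem sum_range_telescope (ht : ∑ i, r i = t) (hF0 : ∀ i, F i 0 = 0)
    (hrec : ∀ i (a : ℕ), r i * (((a : ℂ) + 1) * F i (a + 1)) = a * F i a + f i a) (M : ℕ) :
    ∑ N ∈ range (M + 1), ((∑ i, partSum f F i N) * ∑ x ∈ range (N + 1), g x * t ^ (N - x) +
      N * fullSum F N * g N) =
    t * (((M : ℂ) + 1) * fullSum F (M + 1)) * ∑ x ∈ range (M + 1), g x * t ^ (M - x) := by
  induction M with
  | zero =>
    rw [fullSum_succ ht hF0 hrec]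
    simp
  | succ M ih =>
    have hG : ∑ x ∈ range (M + 1 + 1), g x * t ^ (M + 1 - x) =
        t * ∑ x ∈ range (M + 1), g x * t ^ (M - x) + g (M + 1) := by
      rw [sum_range_succ, mul_sum, Nat.sub_self, pow_zero, mul_one]
      congr 1
      refine sum_congr rfl fun x hx => ?_
      rw [mem_range] at hx
      rw [show M + 1 - x = (M - x) + 1 by omega, pow_succ]
      ring
    rw [sum_range_succ, ih, fullSum_succ ht hF0 hrec (M + 1), hG]
    push_cast
    ring

/-- The partial sums up to M equal the end term of the telescoping sum, so it only remains to show
that its limit L is 0. -/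
theorem tsum_transport (ht : ∑ i, r i = t) (hF0 : ∀ i, F i 0 = 0)
    (hrec : ∀ i (a : ℕ), r i * (((a : ℂ) + 1) * F i (a + 1)) = a * F i a + f i a)
    (hn : ∀ i : Fin n, ∃ k, k ≠ i)
    (hG0 : G 0 = 0) (hG : ∀ N ≠ 0, G N = ∑ x ∈ range (N + 1), g x * t ^ (N - x))
    (h1 : ∀ i, Summable fun a : Fin n → ℕ =>
      conn ℂ a * (f i (a i) * ∏ j ∈ univ.erase i, F j (a j)) * G (∑ j, a j))
    (h2 : Summable fun a : Fin n → ℕ =>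
      conn ℂ a * (∏ j, F j (a j)) * (((∑ j, a j : ℕ) : ℂ) * g (∑ j, a j)))
    (h3 : Summable fun a : Fin n → ℕ => conn ℂ a * (∏ j, F j (a j)) * G (∑ j, a j)) :
    ∑ i, ∑' a : Fin n → ℕ,
        conn ℂ a * (f i (a i) * ∏ j ∈ univ.erase i, F j (a j)) * G (∑ j, a j) +
      ∑' a : Fin n → ℕ, conn ℂ a * (∏ j, F j (a j)) * (((∑ j, a j : ℕ) : ℂ) * g (∑ j, a j)) =
        0 := by
  have hT : ∀ (N : ℕ) (a : Fin n → ℕ), a ∈ Nat.antidiagonalTuple n N ↔ ∑ j, a j = N :=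
    fun N a => Nat.mem_antidiagonalTuple
  have e1 : ∀ i, HasSum (fun N => partSum f F i N * G N) (∑' a : Fin n → ℕ,
        conn ℂ a * (f i (a i) * ∏ j ∈ univ.erase i, F j (a j)) * G (∑ j, a j)) := by
    intro i
    convert! hasSum_sum_fibre (F := Nat.antidiagonalTuple n) _ hT (h1 i) using 2 with N
    rw [partSum, sum_mul]
    exact sum_congr rfl fun a ha => by rw [(hT N a).1 ha]
  have e2 : HasSum (fun N : ℕ => N * fullSum F N * g N) (∑' a : Fin n → ℕ,
      conn ℂ a * (∏ j, F j (a j)) * (((∑ j, a j : ℕ) : ℂ) * g (∑ j, a j))) := by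
    convert! hasSum_sum_fibre (F := Nat.antidiagonalTuple n) _ hT h2 using 2 with N
    rw [fullSum, mul_sum, sum_mul]
    exact sum_congr rfl fun a ha => by rw [(hT N a).1 ha]; ring
  have e3 : Summable fun N : ℕ => fullSum F N * G N := by
    refine (hasSum_sum_fibre (F := Nat.antidiagonalTuple n) _ hT h3).summable.congr fun N => ?_
    rw [fullSum, sum_mul]
    exact sum_congr rfl fun a ha => by rw [(hT N a).1 ha]
  -- `G` and the convolution G' may differ at 0, where `G` vanishes. This is harmless, since a
  -- second component k ≠ i makes the part of size 0 vanish.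
  have hp0 : ∀ i, partSum f F i 0 = 0 := by
    intro i
    obtain ⟨k, hk⟩ := hn i
    refine sum_eq_zero fun a ha => ?_
    rw [hT] at ha
    have : a k = 0 := (sum_eq_zero_iff.1 ha) k (mem_univ k)
    rw [prod_eq_zero (mem_erase.2 ⟨hk, mem_univ k⟩) (by rw [this, hF0])]
    simp
  have e4 := ((hasSum_sum fun i (_ : i ∈ univ) => e1 i).add e2).tendsto_sum_nat.comp
    (tendsto_add_atTop_nat 1)
  set L := ∑ i, ∑' a : Fin n → ℕ,
        conn ℂ a * (f i (a i) * ∏ j ∈ univ.erase i, F j (a j)) * G (∑ j, a j) +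
      ∑' a : Fin n → ℕ, conn ℂ a * (∏ j, F j (a j)) * (((∑ j, a j : ℕ) : ℂ) * g (∑ j, a j))
  set G' : ℕ → ℂ := fun N => ∑ x ∈ range (N + 1), g x * t ^ (N - x) with hG'
  have e5 : Tendsto (fun M : ℕ => t * (((M : ℂ) + 1) * fullSum F (M + 1)) * G' M) atTop
      (𝓝 L) := by
    refine e4.congr fun M => ?_
    rw [← sum_range_telescope ht hF0 hrec M]
    refine sum_congr rfl fun N _ => ?_
    rw [sum_mul]
    congr 1
    refine sum_congr rfl fun i _ => ?_
    rcases eq_or_ne N 0 with rfl | hN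
    · rw [hp0, zero_mul, zero_mul]
    · rw [hG N hN]
  -- Adding the general term of the convergent series `e2` changes t G'(M) into G(M + 1) without
  -- changing the limit.
  have e6 : Tendsto (fun M : ℕ => (((M + 1 : ℕ) : ℂ) * fullSum F (M + 1)) * G (M + 1)) atTop
      (𝓝 L) := by
    have e7 := e5.add (e2.summable.tendsto_atTop_zero.comp (tendsto_add_atTop_nat 1))
    rw [add_zero] at e7
    refine e7.congr fun M => ?_
    have : G (M + 1) = t * G' M + g (M + 1) := by
      rw [hG _ (Nat.succ_ne_zero M), sum_range_succ, hG', mul_sum, Nat.sub_self, pow_zero, mul_one]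
      congr 1
      refine sum_congr rfl fun x hx => ?_
      rw [mem_range] at hx
      rw [show M + 1 - x = (M - x) + 1 by omega, pow_succ]
      ring
    simp only [Function.comp_apply, this]
    push_cast
    ring
  -- Divided by N, the end term becomes the summable sequence of `e3`, which carries arrows on all
  -- components and on the right.
  refine eq_zero_of_tendsto_of_summable_div ((tendsto_add_atTop_iff_nat 1).1 e6) (u := fun M : ℕ =>
    ((M : ℂ) * fullSum F M) * G M) (e3.congr fun N => ?_)
  rcases eq_or_ne N 0 with rfl | hN
  · simp [hG0]
  · have : (N : ℂ) ≠ 0 := Nat.cast_ne_zero.2 hN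
    field_simp

end Telescope

/-! ### Arrows -/

theorem recip_coe (z : ℂ) : recip (z : OnePoint ℂ) = z⁻¹ := rfl

theorem recip_infty : recip ∞ = 0 := rfl

theorem arrow_coe (A : VarIndex) (z : ℂ) : arrow A (z : OnePoint ℂ) = A ++ [(z, 1)] := rfl

theorem arrow_infty (A : VarIndex) : arrow A ∞ = up A := rfl

theorem arrowSign_coe (z : ℂ) : arrowSign (z : OnePoint ℂ) = 1 := rfl

theorem arrowSign_infty : arrowSign ∞ = -1 := rfl

theorem arrowSign_mul_self (v : OnePoint ℂ) : arrowSign v * arrowSign v = 1 := by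
  induction v using OnePoint.rec with
  | infty => rfl
  | coe z => rfl

theorem coe_mem_params {z : ℂ} : (z : OnePoint ℂ) ∈ params ↔ z ≠ 0 ∧ ‖z‖ ≤ 1 := by
  constructor
  · rintro (h | ⟨w, h, hw⟩)
    · exact absurd h (OnePoint.coe_ne_infty z)
    · rwa [OnePoint.coe_injective h]
  · exact fun h => Or.inr ⟨z, rfl, h⟩

theorem infty_mem_params : (∞ : OnePoint ℂ) ∈ params := Or.inl rfl

theorem up_eq_nil {A : VarIndex} : up A = [] ↔ A = [] := by
  rcases List.eq_nil_or_concat A with rfl | ⟨A, ⟨z, k⟩, rfl⟩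
  · simp [up]
  · simp [List.concat_eq_append, up_append]

theorem valid_up {A : VarIndex} (hA : Valid A) : Valid (up A) := by
  rcases List.eq_nil_or_concat A with rfl | ⟨A, ⟨z, k⟩, rfl⟩
  · exact hA
  · rw [List.concat_eq_append] at hA ⊢
    rw [up_append]
    rw [valid_append] at hA ⊢
    refine ⟨hA.1, valid_cons.2 ⟨⟨(valid_cons.1 hA.2).1.1, Nat.le_add_left _ _⟩,
      (valid_cons.1 hA.2).2⟩⟩

theorem valid_arrow {A : VarIndex} (hA : Valid A) {v : OnePoint ℂ} (hv : v ∈ params) :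
    Valid (arrow A v) := by
  induction v using OnePoint.rec with
  | infty => exact valid_up hA
  | coe z =>
    rw [arrow_coe, valid_append]
    refine ⟨hA, valid_cons.2 ⟨⟨(coe_mem_params.1 hv).2, le_rfl⟩, ?_⟩⟩
    intro c hc
    simp at hc

theorem valid_rightArrow {W : VarIndex} (hW : Valid W) {t : ℂ} (ht : ‖t‖ ≤ 1) :
    Valid (rightArrow W t) := by
  rw [rightArrow]
  split_ifs
  · exact valid_up hW
  · rw [valid_append]
    refine ⟨hW, valid_cons.2 ⟨⟨ht, le_rfl⟩, ?_⟩⟩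
    intro c hc
    simp at hc

theorem arrow_ne_nil {A : VarIndex} {v : OnePoint ℂ} (h : A = [] → v ≠ ∞) : arrow A v ≠ [] := by
  induction v using OnePoint.rec with
  | infty =>
    rw [arrow_infty, Ne, up_eq_nil]
    exact fun hA => h hA rfl
  | coe z => simp [arrow_coe]

/-- A last column `(0 over 1)` to the right of the bar has the same effect as the arrow
labelled `0`. -/
theorem mul_weakSum_up {R : Type*} [Field R] [CharZero R] (φ : ℂ →*₀ R) (W : VarIndex) (N : ℕ) :
    (N : R) * weakSum φ (up W) 0 N = N * weakSum φ (W ++ [(0, 1)]) 0 N := by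
  rw [weakSum_append_zero φ W (c := (0, 1)) le_rfl, sum_range_succ, sum_eq_zero]
  · by_cases hW : W = []
    · subst hW
      rcases Nat.eq_zero_or_pos N with rfl | hN
      · simp
      · simp [up, weakSum, hN.ne]
    · rw [weakSum_up φ hW]
      simp
  · intro x hx
    rw [mem_range] at hx
    simp [zero_pow (show N - x ≠ 0 by omega)]

theorem slice_up {R : Type*} [Field R] [CharZero R] (φ : ℂ →*₀ R) {n : ℕ} (A : Fin n → VarIndex)
    (W : VarIndex) : slice φ A (up W) = slice φ A (W ++ [(0, 1)]) := by
  funext a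
  rw [slice, slice, mul_weakSum_up]

theorem slice_rightArrow {R : Type*} [Field R] [CharZero R] (φ : ℂ →*₀ R) {n : ℕ}
    (A : Fin n → VarIndex) (W : VarIndex) (t : ℂ) :
    slice φ A (rightArrow W t) = slice φ A (W ++ [(t, 1)]) := by
  rw [rightArrow]
  split_ifs with h
  · rw [h, slice_up]
  · rfl

/-- The recursion satisfied by a sum over chains with an arrow. -/
theorem recip_mul_strictSum_arrow {A : VarIndex} {v : OnePoint ℂ} (hv : v ∈ params)
    (hA : A = [] → v ≠ ∞) (a : ℕ) :
    recip v * (((a : ℂ) + 1) * (arrowSign v * strictSum idHom (arrow A v) 0 (a + 1))) =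
      a * (arrowSign v * strictSum idHom (arrow A v) 0 a) + strictSum idHom A 0 a := by
  induction v using OnePoint.rec with
  | infty =>
    -- Here 1/v = 0, and the recursion reduces to 0 = -a · (f(a)/a) + f(a): this is the origin of
    -- the sign of the arrow labelled ∞. At a = 0 it needs f(0) = 0, hence a nonempty index.
    have hA' : A ≠ [] := fun h => hA h rfl
    rw [recip_infty, arrowSign_infty, arrow_infty, strictSum_up idHom hA' 0 a,
      strictSum_up idHom hA']
    rcases Nat.eq_zero_or_pos a with rfl | ha
    · simp [strictSum_self idHom hA']
    · have : (a : ℂ) ≠ 0 := Nat.cast_ne_zero.2 ha.ne'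
      push_cast
      field_simp
      ring
  | coe z =>
    obtain ⟨hz, -⟩ := coe_mem_params.1 hv
    -- Clearing the denominator leaves a convolution H with H(b+1) = z (H(b) + f(b)).
    have h : ∀ b : ℕ, (b : ℂ) * strictSum idHom (A ++ [(z, 1)]) 0 b =
        ∑ x ∈ range b, strictSum idHom A 0 x * z ^ (b - x) := by
      intro b
      rw [strictSum_append, pow_one, ← range_eq_Ico]
      rcases Nat.eq_zero_or_pos b with rfl | hb
      · simp
      · have : (b : ℂ) ≠ 0 := Nat.cast_ne_zero.2 hb.ne'
        rw [mul_div_cancel₀ _ this]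
        rfl
    rw [recip_coe, arrowSign_coe, arrow_coe, Int.cast_one, one_mul, one_mul, h a,
      ← Nat.cast_add_one, h (a + 1), sum_range_succ, mul_add, mul_sum]
    congr 1
    · refine sum_congr rfl fun x hx => ?_
      rw [mem_range] at hx
      rw [show a + 1 - x = (a - x) + 1 by omega, pow_succ]
      field_simp
    · rw [Nat.add_sub_cancel_left, pow_one]
      field_simp

/-- The transport relation in its symmetric form. -/
theorem sum_Z_transport {n : ℕ} {A : Fin n → VarIndex} {v : Fin n → OnePoint ℂ} {W : VarIndex}
    {t : ℂ} (hA : ∀ i, Valid (A i)) (hW : Valid W) (htn : ‖t‖ ≤ 1) (hv : ∀ i, v i ∈ params)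
    (ht : ∑ i, recip (v i) = t) (hne : ∀ i, A i = [] → v i ≠ ∞) (hn : ∀ i : Fin n, ∃ k, k ≠ i)
    (hs : ∀ i, Summable (slice absHom (Function.update (fun l => arrow (A l) (v l)) i (A i))
      (rightArrow W t))) :
    ∑ i, (arrowSign (v i) : ℂ) *
        Z (Function.update (fun l => arrow (A l) (v l)) i (A i)) (rightArrow W t) +
      Z (fun l => arrow (A l) (v l)) W = 0 := by
  rcases Nat.eq_zero_or_pos n with rfl | hn0
  · have : ∀ a : Fin 0 → ℕ, slice idHom (fun l => arrow (A l) (v l)) W a = 0 := by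
      intro a
      simp [slice]
    have h' : ∀ a : Fin 0 → ℕ, slice absHom (fun l => arrow (A l) (v l)) W a = 0 := by
      intro a
      simp [slice]
    rw [Z_eq_tsum (summable_zero.congr fun a => (h' a).symm)]
    simp [this]
  obtain ⟨k, hk⟩ := hn ⟨0, hn0⟩
  have hne' : ∀ i, arrow (A i) (v i) ≠ [] := fun i => arrow_ne_nil (hne i)
  have hval : ∀ i, Valid (arrow (A i) (v i)) := fun i => valid_arrow (hA i) (hv i)
  -- With arrows on all of at least two components convergence is automatic. The sums in `hs` may
  -- have only one nonempty component, so their convergence has to be assumed.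
  have s2 : Summable (slice absHom (fun l => arrow (A l) (v l)) W) :=
    summable_slice_of_two hval hW hk (hne' _) (hne' _)
  have s3 : Summable (slice absHom (fun l => arrow (A l) (v l)) (rightArrow W t)) :=
    summable_slice_of_two hval (valid_rightArrow hW htn) hk (hne' _) (hne' _)
  set s : Fin n → ℂ := fun i => (arrowSign (v i) : ℂ) with hsdef
  have hss : ∀ i, s i * s i = 1 := fun i => by
    simp only [hsdef]; exact_mod_cast arrowSign_mul_self (v i)
  set f : Fin n → ℕ → ℂ := fun i a => strictSum idHom (A i) 0 a with hf
  set F : Fin n → ℕ → ℂ := fun i a => s i * strictSum idHom (arrow (A i) (v i)) 0 a with hF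
  -- Each `F i` carries its sign, so all slices acquire the common factor σ; the one without an
  -- arrow at i acquires σ s i, as s i squares to 1.
  set σ : ℂ := ∏ i, s i with hσ
  have hσσ : σ * σ = 1 := by
    rw [hσ, ← prod_mul_distrib]
    exact prod_eq_one fun i _ => hss i
  -- Writing the arrow as an appended column, also for t = 0, avoids a case distinction
  -- (`slice_rightArrow`).
  set G : ℕ → ℂ := fun N => N * weakSum idHom (W ++ [(t, 1)]) 0 N with hG
  have e1 : ∀ i (a : Fin n → ℕ),
      conn ℂ a * (f i (a i) * ∏ j ∈ univ.erase i, F j (a j)) * G (∑ j, a j) =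
        σ * (s i * slice idHom (Function.update (fun l => arrow (A l) (v l)) i (A i))
          (rightArrow W t) a) := by
    intro i a
    rw [slice_rightArrow, slice, hG, ← mul_prod_erase univ
      (fun j => strictSum idHom (Function.update (fun l => arrow (A l) (v l)) i (A i) j) 0 (a j))
      (mem_univ i), Function.update_self]
    have h1 : ∏ j ∈ univ.erase i,
        strictSum idHom (Function.update (fun l => arrow (A l) (v l)) i (A i) j) 0 (a j) =
        ∏ j ∈ univ.erase i, strictSum idHom (arrow (A j) (v j)) 0 (a j) := by
      refine prod_congr rfl fun j hj => ?_
      rw [Function.update_of_ne (ne_of_mem_erase hj)]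
    have h2 : σ * s i = ∏ j ∈ univ.erase i, s j := by
      rw [hσ, ← mul_prod_erase univ s (mem_univ i), mul_comm (s i), mul_assoc, hss, mul_one]
    rw [h1, ← mul_assoc σ, h2, hF, prod_mul_distrib]
    ring
  have e2 : ∀ a : Fin n → ℕ,
      conn ℂ a * (∏ j, F j (a j)) * (((∑ j, a j : ℕ) : ℂ) * weakSum idHom W 0 (∑ j, a j)) =
        σ * slice idHom (fun l => arrow (A l) (v l)) W a := by
    intro a
    rw [slice, hF, prod_mul_distrib]
    ring
  have e3 : ∀ a : Fin n → ℕ,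
      conn ℂ a * (∏ j, F j (a j)) * G (∑ j, a j) =
        σ * slice idHom (fun l => arrow (A l) (v l)) (rightArrow W t) a := by
    intro a
    rw [slice_rightArrow, slice, hF, prod_mul_distrib, hG]
    ring
  have key := tsum_transport (f := f) (F := F) (r := fun i => recip (v i)) (t := t)
    (g := weakSum idHom W 0) (G := G) ht (fun i => by rw [hF]; simp [strictSum_self idHom (hne' i)])
    (fun i a => recip_mul_strictSum_arrow (hv i) (hne i) a) hn (by simp [hG])
    (fun N hN => by
      have : (N : ℂ) ≠ 0 := Nat.cast_ne_zero.2 hN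
      rw [hG]
      simp only
      rw [weakSum_append_zero idHom W (c := (t, 1)) le_rfl, pow_one, mul_div_cancel₀ _ this]
      rfl)
    (fun i => by
      simp only [e1]
      exact ((summable_slice (hs i)).mul_left _).mul_left _)
    (by
      simp only [e2]
      exact (summable_slice s2).mul_left _)
    (by
      simp only [e3]
      exact (summable_slice s3).mul_left _)
  simp only [e1, e2, tsum_mul_left] at key
  rw [← mul_sum, ← mul_add] at key
  have hσ0 : σ ≠ 0 := left_ne_zero_of_mul_eq_one hσσ
  rw [Z_eq_tsum s2, sum_congr rfl fun i _ => by rw [Z_eq_tsum (hs i)]]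
  exact (mul_eq_zero.1 key).resolve_left hσ0

end Transport

/-! ### Soundness and feasibility of the recipe. -/

section Recipe

open Finset

/-! ### Soundness of the recipe -/

/-- Adjoin a last component. -/
abbrev snoc {m : ℕ} (A : Fin m → VarIndex) (B : VarIndex) : Fin (m + 1) → VarIndex :=
  Fin.snoc (α := fun _ => VarIndex) A B

theorem arrow_snoc {m : ℕ} (A : Fin m → VarIndex) (v : Fin m → OnePoint ℂ) (B : VarIndex)
    (v' : OnePoint ℂ) :
    (fun l => arrow (snoc A B l) (Fin.snoc (α := fun _ => OnePoint ℂ) v v' l)) =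
      snoc (fun l => arrow (A l) (v l)) (arrow B v') := by
  funext l
  refine Fin.lastCases ?_ (fun l => ?_) l <;> simp [snoc]

theorem succAbove_snoc {m : ℕ} (A : Fin (m + 1) → VarIndex) (B : VarIndex) (i : Fin (m + 1)) :
    (fun l => snoc A B (i.castSucc.succAbove l)) = snoc (fun l => A (i.succAbove l)) B := by
  funext l
  refine Fin.lastCases ?_ (fun l => ?_) l
  · simp [snoc, Fin.succAbove_ne_last_last (Fin.castSucc_ne_last i)]
  · simp [snoc, Fin.castSucc_succAbove_castSucc]

/-- Convergence is part of the induction: a sum left with one nonempty component converges because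
the recipe for it ends in a permitted boundary step, and this is what the symmetric transport
relation requires. The last component stays nonempty throughout. -/
theorem Recipe.sound {m : ℕ} {A : Fin m → VarIndex} {B W : VarIndex} {c : VarIndex →₀ ℤ}
    (h : Recipe A B W c) (hA : ∀ i, Valid (A i)) (hB : Valid B) (hBne : B ≠ []) (hW : Valid W) :
    c ∈ convergent ∧ Summable (slice absHom (snoc A B) W) ∧ Z (snoc A B) W = evalLi c := by
  induction h with
  | @transport m A v B v' W t c c₀ h hc hc₀ ih ih₀ =>
    have hv := h.mem.1
    have hB' : Valid (arrow B v') := valid_arrow h.valid_last h.last_mem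
    have hBne' : arrow B v' ≠ [] := arrow_ne_nil fun h => absurd h hBne
    have hAne : ∀ l, arrow (A l) (v l) ≠ [] := fun l => arrow_ne_nil (h.ne_infty l)
    have ih₀ := ih₀ hA hB' hBne' h.valid_right
    have ih := fun i => ih i (fun l => by
      rcases eq_or_ne l i with rfl | hl
      · rw [Function.update_self]; exact h.valid l
      · rw [Function.update_of_ne hl]; exact hA l) hB' hBne' hW
    set A' := snoc A B with hA'
    set v'' : Fin (m + 1) → OnePoint ℂ := Fin.snoc (α := fun _ => OnePoint ℂ) v v' with hv''
    have u0 : (fun l => arrow (A' l) (v'' l)) = snoc (fun l => arrow (A l) (v l)) (arrow B v') :=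
      arrow_snoc A v B v'
    have u1 : ∀ i : Fin m, Function.update (fun l => arrow (A' l) (v'' l)) i.castSucc
        (A' i.castSucc) =
        snoc (Function.update (fun l => arrow (A l) (v l)) i (A i)) (arrow B v') := by
      intro i
      rw [u0, hA', snoc, snoc, snoc, Fin.snoc_castSucc, Fin.snoc_update]
    have u2 : Function.update (fun l => arrow (A' l) (v'' l)) (Fin.last m) (A' (Fin.last m)) =
        snoc (fun l => arrow (A l) (v l)) B := by
      rw [u0, hA', snoc, snoc, snoc, Fin.snoc_last, Fin.update_snoc_last]
    have i0 : Fin m := ⟨0, h.one_le⟩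
    have sm : Summable (slice absHom (snoc (fun l => arrow (A l) (v l)) B) (rightArrow W t)) := by
      refine summable_slice_of_two (i := i0.castSucc) (k := Fin.last m) ?_ hW
        (Fin.castSucc_ne_last i0) ?_ ?_
      · refine Fin.lastCases ?_ fun l => ?_
        · simpa [snoc] using hB
        · simpa [snoc] using hA l
      · simpa [snoc] using hAne i0
      · simpa [snoc] using hBne
    have key := sum_Z_transport (A := A') (v := v'') (W := W) (t := t)
      (by
        refine Fin.lastCases ?_ fun l => ?_
        · simpa [hA', snoc] using hB
        · simpa [hA', snoc] using h.valid l)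
      h.valid_right h.norm_le
      (by
        refine Fin.lastCases ?_ fun l => ?_
        · simpa [hv''] using h.last_mem
        · simpa [hv''] using hv l)
      (by
        rw [Fin.sum_univ_castSucc]
        simp only [hv'', Fin.snoc_castSucc, Fin.snoc_last]
        rw [h.last_eq]
        ring)
      (by
        refine Fin.lastCases ?_ fun l => ?_
        · intro h'
          simp only [hA', snoc, Fin.snoc_last] at h'
          exact absurd h' hBne
        · simpa [hA', hv'', snoc] using h.ne_infty l)
      (by
        refine Fin.lastCases ?_ fun l => ?_
        · exact ⟨i0.castSucc, Fin.castSucc_ne_last i0⟩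
        · exact ⟨Fin.last m, (Fin.castSucc_ne_last l).symm⟩)
      (by
        refine Fin.lastCases ?_ fun l => ?_
        · rw [u2]; exact sm
        · rw [u1]; exact (ih l).2.1)
    rw [Fin.sum_univ_castSucc, u2] at key
    simp only [u1, fun i => (ih i).2.2] at key
    rw [u0] at key
    simp only [ih₀.2.2, hv'', Fin.snoc_castSucc, Fin.snoc_last] at key
    refine ⟨sub_mem (neg_mem (sum_mem fun i _ => convergent.smul_mem _ (ih i).1))
      (convergent.smul_mem _ ih₀.1), sm, ?_⟩
    rw [evalLi_sub, evalLi_neg, evalLi_sum, evalLi_zsmul]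
    simp only [evalLi_zsmul]
    have hs : (arrowSign v' : ℂ) * arrowSign v' = 1 := by exact_mod_cast arrowSign_mul_self v'
    have hsum : ∑ i, ((arrowSign (v i) * arrowSign v' : ℤ) : ℂ) * evalLi (c i) =
        arrowSign v' * ∑ i, (arrowSign (v i) : ℂ) * evalLi (c i) := by
      rw [mul_sum]
      refine sum_congr rfl fun i _ => ?_
      push_cast
      ring
    rw [hsum]
    -- In the symmetric relation the wanted value has the coefficient `arrowSign v'`, whose square
    -- is 1.
    linear_combination (arrowSign v' : ℂ) * key -
      Z (snoc (fun l => arrow (A l) (v l)) B) (rightArrow W t) * hs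
  | @drop m A B W c i hi hc ih =>
    obtain ⟨h1, h2, h3⟩ := ih (fun l => hA _) hB hBne hW
    have hi' : snoc A B i.castSucc = [] := by simpa [snoc] using hi
    rw [← succAbove_snoc] at h2 h3
    have h4 := (summable_slice_drop hi').2 h2
    refine ⟨h1, h4, ?_⟩
    rw [Z_eq_tsum h4, tsum_slice_drop W hi', ← Z_eq_tsum h2, h3]
  | zero =>
    refine ⟨zero_mem _, summable_zero.congr fun a => (slice_nil absHom _ a).symm, ?_⟩
    rw [Z, if_pos rfl, evalLi_zero]
  | @zeroColumn m A B W c hc ih =>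
    obtain ⟨h1, h2, h3⟩ := ih hA hB hBne (valid_up (valid_append.1 hW).1)
    rw [Z_eq_tsum h2, slice_up] at h3
    rw [slice_up] at h2
    exact ⟨h1, h2, (Z_eq_tsum h2).trans h3⟩
  | @boundary A B W z w k l h =>
    have h1 := summable_one hB hW h
    obtain ⟨h2, h3⟩ := evalLi_boundary hBne (by simp) hB hW h1
    have h0 : snoc A (B ++ [(z, k)]) 0 = B ++ [(z, k)] := Fin.snoc_last (n := 0) _ _
    have h4 : Summable (slice absHom (snoc A (B ++ [(z, k)])) (W ++ [(w, l)])) := by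
      rw [summable_slice_one, h0]; exact h1
    refine ⟨h2, h4, ?_⟩
    rw [Z_eq_tsum h4, tsum_slice_one, h0, h3]

/-! ### The recipe can be carried out -/

/-- The sum of the entries of the index. -/
def weight (A : VarIndex) : ℕ := (A.map Prod.snd).sum

theorem weight_append (A B : VarIndex) : weight (A ++ B) = weight A + weight B := by
  simp [weight]

theorem weight_singleton (c : ℂ × ℕ) : weight [c] = c.2 := by simp [weight]

theorem valid_singleton {c : ℂ × ℕ} : Valid [c] ↔ ‖c.1‖ ≤ 1 ∧ 1 ≤ c.2 := by simp [Valid]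

/-- The property preserved along the recipe by each component but the last: its variables lie in
`S`, the arrow labelled `∞` is allowed if it is needed, and the first variable is allowed to be
the only one. -/
def LeftAdmissible (S T : Set ℂ) (A : VarIndex) : Prop :=
  Valid A ∧ (∀ c ∈ A, c.1 ∈ S) ∧ ((∃ c ∈ A, c.2 ≠ 1) → ∀ t ∈ T, t = 0 ∨ ‖t‖ = 1) ∧
    ∀ z ∈ (vars A).head?, ∀ t ∈ T, ‖t‖ = 1 → ‖t - 1 / z‖ ≠ 1

/-- The property preserved along the recipe by the component to the right of the bar. -/
def RightAdmissible (T : Set ℂ) (W : VarIndex) : Prop :=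
  Valid W ∧ (∀ c ∈ W, c.1 ∈ T) ∧ ∀ c ∈ W, c.2 ≠ 1 → (0 : ℂ) ∈ T

/-- Transportability, in terms of sets of variables. -/
def AdmissibleSets {m : ℕ} (S : Fin m → Set ℂ) (T : Set ℂ) : Prop :=
  (∀ i, ∀ z ∈ S i, z ≠ 0 ∧ ‖z‖ ≤ 1) ∧
    ∀ J : Finset (Fin m), J.Nonempty → ∀ z : Fin m → ℂ, (∀ i ∈ J, z i ∈ S i) → ∀ t ∈ T,
      ∑ i ∈ J, (z i)⁻¹ = t ∨ 1 ≤ ‖t - ∑ i ∈ J, (z i)⁻¹‖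

theorem AdmissibleSets.succAbove {m : ℕ} {S : Fin (m + 1) → Set ℂ} {T : Set ℂ}
    (h : AdmissibleSets S T) (i : Fin (m + 1)) :
    AdmissibleSets (fun l => S (i.succAbove l)) T := by
  refine ⟨fun l => h.1 _, fun J hJ z hz t ht => ?_⟩
  have := h.2 (J.map i.succAboveEmb) (hJ.map) (i.insertNth (α := fun _ => ℂ) 0 z) (by
    intro l hl
    obtain ⟨l', hl', rfl⟩ := mem_map.1 hl
    simpa using hz l' hl') t ht
  simpa [sum_map] using this

/-- A last exponent above 1 is undone by the arrow labelled ∞, a last exponent 1 by its own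
variable. The weight drops, which drives the induction. If nothing remains, the label is the first
variable, so the condition on first variables applies to it. -/
theorem LeftAdmissible.exists_arrow {S T : Set ℂ} {A : VarIndex} (h : LeftAdmissible S T A)
    (hA : A ≠ []) :
    ∃ (A₀ : VarIndex) (v : OnePoint ℂ), A = arrow A₀ v ∧ LeftAdmissible S T A₀ ∧
      (A₀ = [] → v ≠ ∞) ∧ weight A₀ < weight A ∧
      ((v = ∞ ∧ ∀ t ∈ T, t = 0 ∨ ‖t‖ = 1) ∨ ∃ z ∈ S, v = z) ∧
      (A₀ = [] → ∀ t ∈ T, ‖t‖ = 1 → ‖t - recip v‖ ≠ 1) := by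
  obtain ⟨A, ⟨z, k⟩, rfl⟩ := (List.eq_nil_or_concat A).resolve_left hA
  rw [List.concat_eq_append] at h ⊢
  obtain ⟨h1, h2, h3, h4⟩ := h
  rw [valid_append, valid_singleton] at h1
  rcases Nat.lt_or_ge 1 k with hk | hk
  · obtain ⟨k, rfl⟩ : ∃ k', k = k' + 1 := ⟨k - 1, by omega⟩
    have h5 : ∀ t ∈ T, t = 0 ∨ ‖t‖ = 1 := h3 ⟨(z, k + 1), by simp, by simp only; omega⟩
    refine ⟨A ++ [(z, k)], ∞, (up_append A z k).symm, ⟨?_, ?_, fun _ => h5, ?_⟩, by simp, ?_,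
      Or.inl ⟨rfl, h5⟩, by simp⟩
    · rw [valid_append, valid_singleton]
      exact ⟨h1.1, h1.2.1, by simp only; omega⟩
    · intro c hc
      rw [List.mem_append, List.mem_singleton] at hc
      rcases hc with hc | rfl
      · exact h2 c (by simp [hc])
      · exact h2 (z, k + 1) (by simp)
    · simpa [vars] using h4
    · simp [weight_append, weight_singleton]
  · have hk1 : k = 1 := le_antisymm hk h1.2.2
    subst hk1
    refine ⟨A, z, rfl, ⟨h1.1, fun c hc => h2 c (by simp [hc]), ?_, ?_⟩,
      fun _ => OnePoint.coe_ne_infty z, ?_, Or.inr ⟨z, h2 (z, 1) (by simp), rfl⟩, ?_⟩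
    · rintro ⟨c, hc, hc'⟩
      exact h3 ⟨c, by simp [hc], hc'⟩
    · intro y hy
      refine h4 y ?_
      cases A with
      | nil => simp [vars] at hy
      | cons c A => simpa [vars] using hy
    · simp [weight_append, weight_singleton]
    · rintro rfl t ht ht'
      rw [recip_coe, ← one_div]
      exact h4 z (by simp [vars]) t ht ht'

/-- A last exponent above 1 uses the label 0, which is why 0 is adjoined to the variables of W. A
last column (0 over 1) is reread as an arrow, which replaces W by another pair of no larger weight;
hence the last clause. -/
theorem RightAdmissible.exists_rightArrow {T : Set ℂ} {W : VarIndex} (h : RightAdmissible T W)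
    (hW : W ≠ []) :
    ∃ (W₀ : VarIndex) (t : ℂ), t ∈ T ∧ ‖t‖ ≤ 1 ∧ RightAdmissible T W₀ ∧
      RightAdmissible T (rightArrow W₀ t) ∧ weight W₀ < weight W ∧
      weight (rightArrow W₀ t) ≤ weight W ∧
      ∀ {m : ℕ} (A : Fin m → VarIndex) (B : VarIndex) (c : VarIndex →₀ ℤ),
        Recipe A B (rightArrow W₀ t) c → Recipe A B W c := by
  obtain ⟨W, ⟨w, l⟩, rfl⟩ := (List.eq_nil_or_concat W).resolve_left hW
  rw [List.concat_eq_append] at h ⊢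
  have h' := h
  obtain ⟨h1, h2, h3⟩ := h
  rw [valid_append, valid_singleton] at h1
  have hW0 : RightAdmissible T W :=
    ⟨h1.1, fun c hc => h2 c (by simp [hc]), fun c hc => h3 c (by simp [hc])⟩
  have hw : w ∈ T := h2 (w, l) (by simp)
  rcases Nat.lt_or_ge 1 l with hl | hl
  · obtain ⟨l, rfl⟩ : ∃ l', l = l' + 1 := ⟨l - 1, by omega⟩
    have h0 : (0 : ℂ) ∈ T := h3 (w, l + 1) (by simp) (by simp only; omega)
    have e : rightArrow (W ++ [(w, l)]) 0 = W ++ [(w, l + 1)] := by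
      rw [rightArrow, if_pos rfl, up_append]
    refine ⟨W ++ [(w, l)], 0, h0, by simp, ⟨?_, ?_, fun _ _ _ => h0⟩, by rwa [e], ?_,
      by rw [e], by rw [e]; exact fun _ _ _ => id⟩
    · rw [valid_append, valid_singleton]
      exact ⟨h1.1, h1.2.1, by simp only; omega⟩
    · intro c hc
      rw [List.mem_append, List.mem_singleton] at hc
      rcases hc with hc | rfl
      · exact h2 c (by simp [hc])
      · exact hw
    · simp [weight_append, weight_singleton]
  · have hl1 : l = 1 := le_antisymm hl h1.2.2
    subst hl1
    by_cases hw0 : w = 0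
    · subst hw0
      have e : rightArrow W 0 = up W := if_pos rfl
      refine ⟨W, 0, hw, by simp, hW0, ?_, by simp [weight_append, weight_singleton], ?_, ?_⟩
      · rw [e]
        refine ⟨valid_up h1.1, ?_, fun _ _ _ => hw⟩
        rcases List.eq_nil_or_concat W with rfl | ⟨W, ⟨y, l⟩, rfl⟩
        · simp [up]
        · rw [List.concat_eq_append, up_append]
          intro c hc
          rw [List.mem_append, List.mem_singleton] at hc
          rcases hc with hc | rfl
          · exact h2 c (by simp [hc])
          · exact h2 (y, l) (by simp)
      · rw [e]
        rcases List.eq_nil_or_concat W with rfl | ⟨W, ⟨y, l⟩, rfl⟩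
        · simp [up, weight]
        · simp [List.concat_eq_append, up_append, weight]
      · rw [e]
        exact fun _ _ _ => Recipe.zeroColumn
    · have e : rightArrow W w = W ++ [(w, 1)] := if_neg hw0
      exact ⟨W, w, hw, h1.2.1, hW0, by rwa [e], by simp [weight_append, weight_singleton],
        by rw [e], by rw [e]; exact fun _ _ _ => id⟩

/-- The label of the last component in the transport relation. -/
theorem exists_label {t s : ℂ} (h : s = t ∨ 1 ≤ ‖t - s‖) :
    ∃ v ∈ params, recip v = t - s := by
  by_cases hs : t - s = 0
  · exact ⟨∞, infty_mem_params, by rw [hs, recip_infty]⟩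
  · have h1 : 1 ≤ ‖t - s‖ := h.resolve_left fun h => hs (by rw [h, sub_self])
    refine ⟨((t - s)⁻¹ : ℂ), coe_mem_params.2 ⟨inv_ne_zero hs, ?_⟩, ?_⟩
    · rw [norm_inv]; exact inv_le_one_of_one_le₀ h1
    · rw [recip_coe, inv_inv]

/-- Labels ∞ add nothing to the sum, so the condition is the one for the subset J of finite labels.
If J is empty, it says t = 0 or |t| ≥ 1, which the presence of a label ∞ guarantees. -/
theorem mem_BSet_of_admissible {m : ℕ} (hm : 1 ≤ m) {S : Fin m → Set ℂ} {T : Set ℂ}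
    (hS : AdmissibleSets S T) {v : Fin m → OnePoint ℂ}
    (hv : ∀ i, (v i = ∞ ∧ ∀ t ∈ T, t = 0 ∨ ‖t‖ = 1) ∨ ∃ z ∈ S i, v i = z) {t : ℂ} (ht : t ∈ T) :
    v ∈ BSet (Fin m) t := by
  classical
  refine ⟨fun i => ?_, ?_⟩
  · rcases hv i with h | ⟨z, hz, h⟩
    · rw [h.1]; exact infty_mem_params
    · rw [h]; exact coe_mem_params.2 (hS.1 i z hz)
  · by_cases hJ : (univ.filter fun i => v i ≠ ∞).Nonempty
    · have h1 := hS.2 _ hJ (fun i => (recip (v i))⁻¹) (by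
        intro i hi
        rcases hv i with h | ⟨z, hz, h⟩
        · exact absurd h.1 (mem_filter.1 hi).2
        · rw [h, recip_coe, inv_inv]; exact hz) t ht
      have h2 : ∑ i ∈ univ.filter (fun i => v i ≠ ∞), (recip (v i))⁻¹⁻¹ = ∑ i, recip (v i) := by
        rw [sum_filter]
        refine sum_congr rfl fun i _ => ?_
        split_ifs with h
        · rw [inv_inv]
        · rw [not_not.1 h, recip_infty]
      rwa [h2] at h1
    · rw [not_nonempty_iff_eq_empty, filter_eq_empty_iff] at hJ
      have h1 : ∀ i, v i = ∞ := fun i => not_not.1 (hJ (mem_univ i))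
      have h2 : ∑ i, recip (v i) = 0 := sum_eq_zero fun i _ => by rw [h1, recip_infty]
      rw [h2, sub_zero]
      rcases hv ⟨0, hm⟩ with h | ⟨z, _, h⟩
      · exact (h.2 t ht).imp Eq.symm (fun h => h.ge)
      · exact absurd ((h1 _).symm.trans h) (OnePoint.infty_ne_coe z)

/-- The boundary condition applies once the only other component has become empty. -/
theorem exists_recipe_one {B W : VarIndex} {v v' : OnePoint ℂ} {t : ℂ} (hB : Valid B)
    (hBne : B ≠ []) (hW : Valid W) (ht : ‖t‖ ≤ 1) (hv' : v' ∈ params)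
    (hvv' : recip v' = t - recip v) (h : ‖t‖ = 1 → ‖t - recip v‖ ≠ 1) (A : Fin 0 → VarIndex) :
    ∃ c, Recipe A (arrow B v') (rightArrow W t) c := by
  have key : ∀ {l : ℕ} {w : ℂ} {W' : VarIndex}, rightArrow W t = W' ++ [(w, l)] →
      (l = 1 → w = t) → ∃ c, Recipe A (arrow B v') (rightArrow W t) c := by
    intro l w W' e hlw
    rw [e]
    induction v' using OnePoint.rec with
    | infty =>
      obtain ⟨B, ⟨z, k⟩, rfl⟩ := (List.eq_nil_or_concat B).resolve_left hBne
      rw [List.concat_eq_append] at hB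
      rw [List.concat_eq_append, arrow_infty, up_append]
      have hk := (valid_singleton.1 (valid_append.1 hB).2).2
      exact ⟨_, Recipe.boundary fun hk' => by simp only at hk; omega⟩
    | coe z =>
      rw [arrow_coe]
      refine ⟨_, Recipe.boundary fun _ hl => ?_⟩
      rw [hlw hl]
      rcases lt_or_eq_of_le ht with ht' | ht'
      · exact Or.inr ht'
      · left
        -- If |z| = 1, then |t - 1/v| = |1/z| = 1, which is excluded.
        refine lt_of_le_of_ne (coe_mem_params.1 hv').2 fun hz => h ht' ?_
        rw [← hvv', recip_coe, norm_inv, hz, inv_one]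
  by_cases h0 : t = 0
  · rcases List.eq_nil_or_concat W with rfl | ⟨W, ⟨w, l⟩, rfl⟩
    · rw [rightArrow, if_pos h0]
      exact ⟨0, Recipe.zero⟩
    · rw [List.concat_eq_append] at hW
      have hl := (valid_singleton.1 (valid_append.1 hW).2).2
      refine key (l := l + 1) (w := w) (W' := W) ?_ fun h => ?_
      · rw [rightArrow, if_pos h0, List.concat_eq_append, up_append]
      · simp only at hl; omega
  · exact key (l := 1) (w := t) (W' := W) (if_neg h0) fun _ => rfl

/-- The last component only grows and is left out of the weight. Each summand of a transport step
lowers the weight of one other component or of W. A component that becomes empty is dropped; if it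
was the only one, the boundary condition takes over. -/
theorem exists_recipe (k : ℕ) {m : ℕ} (hm : 1 ≤ m) {S : Fin m → Set ℂ} {T : Set ℂ}
    (hS : AdmissibleSets S T) {A : Fin m → VarIndex} {B W : VarIndex}
    (hA : ∀ i, LeftAdmissible (S i) T (A i)) (hAne : ∀ i, A i ≠ []) (hB : Valid B)
    (hBne : B ≠ []) (hW : RightAdmissible T W) (hk : ∑ i, weight (A i) + weight W < k) :
    ∃ c, Recipe A B W c := by
  induction k generalizing m B W with
  | zero => omega
  | succ k ih =>
    by_cases hWne : W = []
    · subst hWne; exact ⟨0, Recipe.zero⟩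
    choose A₀ v hAv hA₀ hne hwt hv hhead using fun i => (hA i).exists_arrow (hAne i)
    obtain ⟨W₀, t, htT, ht, hW₀, hWt, hwW₀, hwWt, hrec⟩ := hW.exists_rightArrow hWne
    obtain rfl : A = fun l => arrow (A₀ l) (v l) := funext hAv
    beta_reduce at hk hwt
    have hmem := mem_BSet_of_admissible hm hS hv htT
    obtain ⟨v', hv', hvv'⟩ := exists_label hmem.2
    have hB' : Valid (arrow B v') := valid_arrow hB hv'
    have hBne' : arrow B v' ≠ [] := arrow_ne_nil fun h => absurd h hBne
    obtain ⟨c₀, hc₀⟩ := ih hm hS hA hAne hB' hBne' hW₀ (by omega)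
    have hc : ∀ i, ∃ c, Recipe (Function.update (fun l => arrow (A₀ l) (v l)) i (A₀ i))
        (arrow B v') (rightArrow W₀ t) c := by
      intro i
      by_cases hi : A₀ i = []
      · obtain ⟨m, rfl⟩ : ∃ m', m = m' + 1 := ⟨m - 1, by omega⟩
        have hu : (fun l => Function.update (fun l => arrow (A₀ l) (v l)) i (A₀ i)
            (i.succAbove l)) = fun l => arrow (A₀ (i.succAbove l)) (v (i.succAbove l)) := by
          funext l
          rw [Function.update_of_ne (Fin.succAbove_ne i l)]
        suffices h : ∃ c, Recipe (fun l => arrow (A₀ (i.succAbove l)) (v (i.succAbove l)))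
            (arrow B v') (rightArrow W₀ t) c by
          obtain ⟨c, hc⟩ := h
          rw [← hu] at hc
          exact ⟨c, Recipe.drop i (by rw [Function.update_self, hi]) hc⟩
        rcases Nat.eq_zero_or_pos m with rfl | hm'
        · obtain rfl : i = 0 := Fin.fin_one_eq_zero i
          refine exists_recipe_one (v := v 0) hB hBne hW₀.1 ht hv' ?_ (hhead 0 hi t htT) _
          rw [hvv', Fin.sum_univ_one]
        · refine ih hm' (hS.succAbove i) (fun l => hA _) (fun l => hAne _) hB' hBne' hWt ?_
          rw [Fin.sum_univ_succAbove _ i] at hk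
          have := hwt i
          omega
      · refine ih hm hS (fun l => ?_) (fun l => ?_) hB' hBne' hWt ?_
        · rcases eq_or_ne l i with rfl | hl
          · rw [Function.update_self]; exact hA₀ l
          · rw [Function.update_of_ne hl]; exact hA l
        · rcases eq_or_ne l i with rfl | hl
          · rw [Function.update_self]; exact hi
          · rw [Function.update_of_ne hl]; exact hAne l
        · have : ∑ l, weight (Function.update (fun l => arrow (A₀ l) (v l)) i (A₀ i) l) <
              ∑ l, weight (arrow (A₀ l) (v l)) := by
            refine sum_lt_sum (fun l _ => ?_) ⟨i, mem_univ i, ?_⟩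
            · rcases eq_or_ne l i with rfl | hl
              · rw [Function.update_self]; exact (hwt l).le
              · rw [Function.update_of_ne hl]
            · rw [Function.update_self]; exact hwt i
          omega
    choose c hc using hc
    refine ⟨_, hrec _ _ _ (Recipe.transport (c := c) (c₀ := c₀)
      { one_le := hm
        valid := fun i => (hA₀ i).1
        valid_last := hB
        valid_right := hW₀.1
        norm_le := ht
        mem := hmem
        last_mem := hv'
        last_eq := hvv'
        ne_infty := hne
        ne_sum := fun h => absurd h hBne
        two_first := fun _ h i hi => hhead i hi t htT h
        two_last := fun _ _ h => absurd h hBne } hc hc₀)⟩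

end Recipe

/-! ### Choice of the last component, and assembly of the theorem. -/

section Main

open Finset Filter Topology

/-! ### Permutations of the components -/

theorem slice_comp_perm {R : Type*} [Field R] (φ : ℂ →*₀ R) {n : ℕ} (A : Fin n → VarIndex)
    (W : VarIndex) (σ : Equiv.Perm (Fin n)) (a : Fin n → ℕ) :
    slice φ (fun i => A (σ i)) W (fun i => a (σ i)) = slice φ A W a := by
  rw [slice, slice, conn, conn, Equiv.sum_comp σ a,
    Equiv.prod_comp σ fun i => ((a i).factorial : R),
    Equiv.prod_comp σ fun i => strictSum φ (A i) 0 (a i)]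

theorem Z_comp_perm {n : ℕ} {A : Fin n → VarIndex} {W : VarIndex} (σ : Equiv.Perm (Fin n))
    (h : Summable (slice absHom A W)) : Z (fun i => A (σ i)) W = Z A W := by
  let e : (Fin n → ℕ) ≃ (Fin n → ℕ) := Equiv.arrowCongr σ.symm (Equiv.refl ℕ)
  have he : ∀ a, e a = fun i => a (σ i) := fun a => rfl
  have h' : Summable (slice absHom (fun i => A (σ i)) W) := by
    rw [← e.summable_iff]
    refine h.congr fun a => ?_
    rw [Function.comp_apply, he, slice_comp_perm]
  rw [Z_eq_tsum h', Z_eq_tsum h, ← e.tsum_eq]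
  exact tsum_congr fun a => by rw [he, slice_comp_perm]

/-! ### Multiples of values of the logarithm -/

/-- Each complex number is an integral multiple of a convergent multiple polylogarithm
`Li₁(z) = -log (1 - z)`. This serves for connected sums on which the recipe gets stuck, because a
column `(z over k)` with `k ≥ 2` meets a variable `w` with `0 < |w| < 1` to the right of the bar. -/
theorem exists_evalLi_eq (x : ℂ) : ∃ c ∈ convergent, evalLi c = x := by
  have h0 : Tendsto (fun N : ℕ => x / N) atTop (𝓝 0) := tendsto_const_div_atTop_nhds_zero_nat x
  have h1 : Tendsto (fun N : ℕ => ‖1 - Complex.exp (-(x / N))‖) atTop (𝓝 0) := by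
    have : Tendsto (fun y : ℂ => ‖1 - Complex.exp (-y)‖) (𝓝 0) (𝓝 ‖1 - Complex.exp (-0)‖) :=
      Continuous.tendsto (by fun_prop) 0
    simp only [neg_zero, Complex.exp_zero, sub_self, norm_zero] at this
    exact this.comp h0
  -- For large N the point z = 1 - exp(-x/N) lies in the open disk, and |Im(x/N)| < π makes the
  -- principal logarithm of 1 - z equal to -x/N.
  obtain ⟨N, hN1, hN2, hN3⟩ := ((h1.eventually_lt_const one_pos).and
    ((h0.norm.eventually_lt_const (u := Real.pi) (by simpa using Real.pi_pos)).and
      (eventually_gt_atTop 0))).exists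
  set z := 1 - Complex.exp (-(x / N)) with hz
  have hN : (N : ℂ) ≠ 0 := Nat.cast_ne_zero.2 hN3.ne'
  have hterm : ∀ {R : Type} [Field R] (φ : ℂ →*₀ R) (m : ℕ),
      strictSum φ [(z, 1)] 0 m = φ z ^ m / m := by
    intro R _ φ m
    rcases Nat.eq_zero_or_pos m with rfl | hm
    · simp [strictSum]
    · simp [strictSum, hm]
  have hs : Summable (strictSum absHom [(z, 1)] 0) := by
    refine Summable.of_nonneg_of_le (strictSum_nonneg _ 0) (fun m => ?_)
      (summable_geometric_of_lt_one (norm_nonneg z) hN1)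
    rw [hterm]
    rcases Nat.eq_zero_or_pos m with rfl | hm
    · simp
    · exact div_le_self (pow_nonneg (norm_nonneg z) m) (by exact_mod_cast hm)
  have hLi : Li [(z, 1)] = x / N := by
    have h2 := Complex.hasSum_taylorSeries_neg_log hN1
    have him := (Complex.abs_im_le_norm (-(x / N))).trans_lt (by rwa [norm_neg])
    rw [hz, sub_sub_cancel, Complex.log_exp (abs_lt.1 him).1 (abs_lt.1 him).2.le, neg_neg] at h2
    rw [Li_eq_tsum hs, ← h2.tsum_eq]
    exact tsum_congr fun m => hterm idHom m
  refine ⟨Finsupp.single [(z, 1)] (N : ℤ), single_mem_convergent ⟨by simp, ?_, ?_⟩ _, ?_⟩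
  · exact valid_singleton.2 ⟨hN1.le, le_rfl⟩
  · exact (summable_chainTerm_iff _).2 hs
  · rw [evalLi_single, hLi]
    push_cast
    field_simp

/-! ### Transportable variables -/

theorem coe_get_mem {A : VarIndex} {z : ℂ} (hz : z ∈ vars A) :
    ∃ a : Fin (vars A).length, (vars A).get a = z := List.mem_iff_get.1 hz

theorem extVars_ne_nil {W : VarIndex} (hW : W ≠ []) : ∃ t, t ∈ extVars W := by
  obtain ⟨c, hc⟩ := List.exists_mem_of_ne_nil W hW
  refine ⟨c.1, ?_⟩
  have : c.1 ∈ vars W := List.mem_map_of_mem hc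
  rw [extVars]
  split_ifs
  · exact this
  · exact List.mem_append_left _ this

theorem vars_subset_extVars {W : VarIndex} {t : ℂ} (ht : t ∈ vars W) : t ∈ extVars W := by
  rw [extVars]
  split_ifs
  · exact ht
  · exact List.mem_append_left _ ht

theorem zero_mem_extVars {W : VarIndex} (hW : ¬ AllOnes W) : (0 : ℂ) ∈ extVars W := by
  rw [extVars, if_neg hW]
  simp

theorem mem_extVars {W : VarIndex} {t : ℂ} (ht : t ∈ extVars W) : t = 0 ∨ t ∈ vars W := by
  rw [extVars] at ht
  split_ifs at ht
  · exact Or.inr ht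
  · rw [List.mem_append, List.mem_singleton] at ht
    exact ht.symm

/-- The definition quantifies over positions in the tuples; the induction needs only the values
occurring there. -/
theorem TransportableAt.sum_eq_or {n : ℕ} {A : Fin n → VarIndex} {w : List ℂ} {j : Fin n}
    (h : TransportableAt (fun i => vars (A i)) w j) {J : Finset (Fin n)} (hJ : J.Nonempty)
    (hj : j ∉ J) {z : Fin n → ℂ} (hz : ∀ i ∈ J, z i ∈ vars (A i)) {t : ℂ} (ht : t ∈ w) :
    (∀ i ∈ J, z i ≠ 0 ∧ ‖z i‖ ≤ 1) ∧
      (∑ i ∈ J, (z i)⁻¹ = t ∨ 1 ≤ ‖t - ∑ i ∈ J, (z i)⁻¹‖) := by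
  choose a ha using fun i : J => coe_get_mem (hz i i.2)
  have h1 := (h J hJ hj).1 a t ht
  have h2 : (fun i : J => (((vars (A i)).get (a i) : ℂ) : OnePoint ℂ)) =
      fun i : J => ((z i : ℂ) : OnePoint ℂ) := funext fun i => congrArg _ (ha i)
  beta_reduce at h1
  rw [h2] at h1
  refine ⟨fun i hi => coe_mem_params.1 (h1.1 ⟨i, hi⟩), ?_⟩
  have h3 : ∑ i : J, recip ((z i : ℂ) : OnePoint ℂ) = ∑ i ∈ J, (z i)⁻¹ :=
    sum_coe_sort J fun i => (z i)⁻¹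
  have h4 := h1.2
  beta_reduce at h4
  rwa [h3] at h4

section Start

variable {n : ℕ} {A : Fin (n + 1) → VarIndex} {W : VarIndex} {j : Fin (n + 1)}

/-- The positions of the components but the last after `j` has been interchanged with the last
position. -/
def position (j : Fin (n + 1)) (i : Fin n) : Fin (n + 1) := Equiv.swap j (Fin.last n) i.castSucc

theorem position_injective (j : Fin (n + 1)) : Function.Injective (position j) :=
  (Equiv.injective _).comp (Fin.castSucc_injective n)

theorem position_ne (j : Fin (n + 1)) (i : Fin n) : position j i ≠ j := by
  intro h
  rw [position, Equiv.swap_apply_eq_iff, Equiv.swap_apply_left] at h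
  exact Fin.castSucc_ne_last i h

theorem snoc_position (A : Fin (n + 1) → VarIndex) (j : Fin (n + 1)) :
    snoc (fun i => A (position j i)) (A j) = fun i => A (Equiv.swap j (Fin.last n) i) := by
  funext i
  refine Fin.lastCases ?_ (fun i => ?_) i
  · simp [snoc, Equiv.swap_apply_right]
  · simp [snoc, position]

theorem admissibleSets_position (hW : W ≠ [])
    (h : TransportableAt (fun i => vars (A i)) (extVars W) j) :
    AdmissibleSets (fun i => {z | z ∈ vars (A (position j i))}) {t | t ∈ extVars W} := by
  constructor
  · intro i z hz
    -- That the variables are nonzero is contained in transportability for a singleton J, but only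
    -- once some t is available; hence W must be nonempty.
    obtain ⟨t, ht⟩ := extVars_ne_nil hW
    exact (h.sum_eq_or (J := {position j i}) (singleton_nonempty _)
      (by simpa using (position_ne j i).symm) (z := fun _ => z) (by simpa using hz) ht).1 _
      (mem_singleton_self _)
  · intro J hJ z hz t ht
    have hext : ∀ i, Function.extend (position j) z 0 (position j i) = z i :=
      (position_injective j).extend_apply z 0
    have h1 := (h.sum_eq_or (J := J.map ⟨position j, position_injective j⟩) hJ.map
      (by
        rw [Finset.mem_map]
        rintro ⟨i, _, hi⟩
        exact position_ne j i hi) (z := Function.extend (position j) z 0)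
      (by
        intro i hi
        obtain ⟨i, hi', rfl⟩ := Finset.mem_map.1 hi
        rw [Function.Embedding.coeFn_mk, hext]
        exact hz i hi') ht).2
    simpa only [sum_map, Function.Embedding.coeFn_mk, hext] using h1

theorem leftAdmissible_position (hA : ∀ i, Valid (A i))
    (h : TransportableAt (fun i => vars (A i)) (extVars W) j)
    (h' : (∃ i, i ≠ j ∧ ¬ AllOnes (A i)) → ∀ w ∈ vars W, w = 0 ∨ ‖w‖ = 1) (i : Fin n) :
    LeftAdmissible {z | z ∈ vars (A (position j i))} {t | t ∈ extVars W} (A (position j i)) := by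
  refine ⟨hA _, fun c hc => List.mem_map_of_mem hc, ?_, ?_⟩
  · rintro ⟨c, hc, hc1⟩ t ht
    rcases mem_extVars ht with ht | ht
    · exact Or.inl ht
    · exact h' ⟨_, position_ne j i, fun hall => hc1 (hall c hc)⟩ t ht
  · intro z hz t ht ht1
    exact (h {position j i} (singleton_nonempty _)
      (by simpa using (position_ne j i).symm)).2 t ht ht1 _ (position_ne j i) z hz

theorem rightAdmissible_extVars (hW : Valid W) : RightAdmissible {t | t ∈ extVars W} W :=
  ⟨hW, fun _ hc => vars_subset_extVars (List.mem_map_of_mem hc),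
    fun _ hc hc1 => zero_mem_extVars fun hall => hc1 (hall _ hc)⟩

theorem exists_recipe_of_transportableAt (hn : 1 ≤ n) (hA : ∀ i, A i ≠ [] ∧ Valid (A i))
    (hW : W ≠ [] ∧ Valid W) (h : TransportableAt (fun i => vars (A i)) (extVars W) j)
    (h' : (∃ i, i ≠ j ∧ ¬ AllOnes (A i)) → ∀ w ∈ vars W, w = 0 ∨ ‖w‖ = 1) :
    ∃ c : VarIndex →₀ ℤ, Recipe (fun i : Fin n => A (position j i)) (A j) W c :=
  exists_recipe _ hn (admissibleSets_position hW.1 h)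
    (leftAdmissible_position (fun i => (hA i).2) h h') (fun _ => (hA _).1) (hA j).2 (hA j).1
    (rightAdmissible_extVars hW.2) (Nat.lt_succ_self _)

theorem summable_slice_of_one_le (hn : 1 ≤ n) (hA : ∀ i, A i ≠ [] ∧ Valid (A i))
    (hW : Valid W) : Summable (slice absHom A W) :=
  summable_slice_of_two (i := 0) (k := Fin.last n) (fun i => (hA i).2) hW
    (by simp only [ne_eq, Fin.ext_iff, Fin.val_zero, Fin.val_last]; omega) (hA _).1 (hA _).1

theorem evalLi_eq_of_recipe (hn : 1 ≤ n) (hA : ∀ i, A i ≠ [] ∧ Valid (A i)) (hW : Valid W)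
    {c : VarIndex →₀ ℤ} (hc : Recipe (fun i : Fin n => A (position j i)) (A j) W c) :
    (∀ X ∈ c.support, IsConvergentMPL X) ∧ Z A W = evalLi c := by
  obtain ⟨h1, -, h3⟩ := hc.sound (fun i => (hA _).2) (hA j).2 (hA j).1 hW
  refine ⟨mem_convergent.1 h1, ?_⟩
  rw [← h3, snoc_position, Z_comp_perm _ (summable_slice_of_one_le hn hA hW)]

end Start

end Main

end

end ConnectedSum

open ConnectedSum
theorem theorem5p2 (n : ℕ) (hn : 1 ≤ n) (A : Fin (n + 1) → VarIndex) (W : VarIndex)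
    (hA : ∀ i, A i ≠ [] ∧ Valid (A i)) (hW : W ≠ [] ∧ Valid W)
    (hT : Transportable (fun i => vars (A i)) (extVars W)) :
    (Summable fun p : summationSet A W => ‖connTerm A W p‖) ∧
    (∃ c : VarIndex →₀ ℤ, (∀ X ∈ c.support, IsConvergentMPL X) ∧ Z A W = evalLi c) ∧
    ∀ j : Fin (n + 1), TransportableAt (fun i => vars (A i)) (extVars W) j →
      ((∃ i, i ≠ j ∧ ¬ AllOnes (A i)) → ∀ w ∈ vars W, w = 0 ∨ ‖w‖ = 1) →
      (∃ c : VarIndex →₀ ℤ,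
        Recipe (fun i : Fin n => A (Equiv.swap j (Fin.last n) i.castSucc)) (A j) W c) ∧
      ∀ c : VarIndex →₀ ℤ,
        Recipe (fun i : Fin n => A (Equiv.swap j (Fin.last n) i.castSucc)) (A j) W c →
        (∀ X ∈ c.support, IsConvergentMPL X) ∧ Z A W = evalLi c := by
  refine ⟨(summable_connTerm_iff A W).2 (summable_slice_of_one_le hn hA hW.2), ?_,
    fun j hj hj' => ⟨exists_recipe_of_transportableAt hn hA hW hj hj',
      fun c hc => evalLi_eq_of_recipe hn hA hW.2 hc⟩⟩
  obtain ⟨j, hj⟩ := hT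
  by_cases hj' : (∃ i, i ≠ j ∧ ¬ AllOnes (A i)) → ∀ w ∈ vars W, w = 0 ∨ ‖w‖ = 1
  · obtain ⟨c, hc⟩ := exists_recipe_of_transportableAt hn hA hW hj hj'
    exact ⟨c, evalLi_eq_of_recipe hn hA hW.2 hc⟩
  -- The first claim asks only for some combination, so a multiple of a single logarithm value
  -- suffices here.
  · obtain ⟨c, hc, h⟩ := exists_evalLi_eq (Z A W)
    exact ⟨c, hc, h.symm⟩
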